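/- Let $\mathbb H$ be the category freely generated by the graph with vertices $n, n_t$ $(n\ge 1)$ and edges $n\to n+1$ and $n\to n_t$. For a presheaf $X\in[\mathbb H^{\mathrm{op}},\mathbf{Set}]$, write $\partial$ for the maps $X(n+1)\to X(n)$ and $X(n_t)\to X(n)$; elements of $X(n)$ and $X(n_t)$ are called type-elements and term-elements of degree $n$, and for $A\in X(n)$ we put $\mathrm{Tm}_X(A)=\{a\in X(n_t):\partial a=A\}$. An $\{s\}$-GAT is a generalised algebraic theory whose only deduction rules are those for equality, renaming of variables and substitution (no weakening, no projection). The free $\{s\}$-GAT $GX$ on $X$ has the type-elements of $X$ as type-constants, the term-elements of $X$ as term-constants, and as basic judgements $$x_1:A_1,\dots,x_{n-1}:A_{n-1}(x_1,\dots,x_{n-2})\vdash A(x_1,\dots,x_{n-1})\ \mathsf{type}$$ for each $A\in X(n)$ with successive boundaries $A_{n-1},\dots,A_1$, and $$x_1:A_1,\dots,x_{n-1}:A_{n-1}(x_1,\dots,x_{n-2})\vdash a(x_1,\dots,x_{n-1}):A(x_1,\dots,x_{n-1})$$ for each $a\in \mathrm{Tm}_X(A)$. Let $SX$ be the presheaf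 for which $SX(n)$ (respectively $SX(n_t)$) is the set of derivable type (respectively term) judgements of $GX$ with a context of length $n-1$, modulo derivable equality up to renaming of the declared variables. Here $\partial$ sends $\Gamma,x:T\vdash T'\ \mathsf{type}$ to $\Gamma\vdash T\ \mathsf{type}$, and $\Gamma\vdash t:T$ to $\Gamma\vdash T\ \mathsf{type}$. A map $f\colon X\to Y$ acts on $S$ by relabelling constants; $S$ is the underlying endofunctor of the free-$\{s\}$-GAT (substitution) monad. For $n\geq 1$ let $\mathrm{Inc}(n)$ be the set of strictly increasing functions $\alpha\colon\{0,\dots,n\}\to\mathbb N$ with $\alpha(0)=0$, and for $\alpha\in\mathrm{Inc}(n+1)$ let $\partial\alpha\in\mathrm{Inc}(n)$ be its restriction. For $\alpha\in\mathrm{Inc}(n)$ let $[\alpha]$ be the presheaf on $\mathbb H$ with $[\alpha](i)=\{i\}$ if $i\le\alpha(n)$ and $\emptyset$ otherwise, and $[\alpha](i_t)=\{i_t\}$ if $i\le\alpha(n)$ and $i\notin\operatorname{im}\alpha$, and $\emptyset$ otherwise. For $h\colon[\alpha]\to X$ with $\alpha\in\mathrm{Inc}(n+1)$, let $\partial h$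 be the restriction of $h$ along $[\partial\alpha]\hookrightarrow[\alpha]$. **Proposition.** Up to an isomorphism of presheaves, natural in $X$, the presheaf $SX$ has type-elements $$SX(n)=\sum_{\alpha\in\mathrm{Inc}(n)}[\mathbb H^{\mathrm{op}},\mathbf{Set}]([\alpha],X),\qquad \partial(\alpha,h)=(\partial\alpha,\partial h),$$ and term-elements $\mathrm{Tm}_{SX}(\alpha,h)=\mathrm{Tm}_X(h(\alpha(n)))$ for each $(\alpha,h)\in SX(n)$. (A map $f\colon X\to Y$ acts on the right-hand sides by $(\alpha,h)\mapsto(\alpha,f\circ h)$ and $a\mapsto f(a)$.) -/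

import Mathlib

open CategoryTheory Opposite

universe u v

namespace SubstGAT

/-! ## Type-and-term structures -/

/-- The objects of the category `H`.  Degrees `1, 2, 3, …` are counted from zero: `ty k` is the
object `k+1`, and `tm k` is the object `(k+1)_t`. -/
inductive Shape : Type
  | ty (k : ℕ)
  | tm (k : ℕ)

/-- The generating arrows `n ⟶ n+1` and `n ⟶ n_t`. -/
inductive Shape.Arrow : Shape → Shape → Type
  | ext (k : ℕ) : Shape.Arrow (.ty k) (.ty (k + 1))
  | bd (k : ℕ) : Shape.Arrow (.ty k) (.tm k)

instance : Quiver Shape := ⟨Shape.Arrow⟩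

/-- The category `H` freely generated by the graph. -/
abbrev HCat : Type := Paths Shape

/-- Type-and-term structures: presheaves on `H`. -/
abbrev TTS : Type (u + 1) := HCatᵒᵖ ⥤ Type u

namespace TTS

/-- Type-elements of degree `k+1`. -/
abbrev Ty (X : TTS.{u}) (k : ℕ) : Type u := X.obj (op ((Paths.of Shape).obj (.ty k)))

/-- Term-elements of degree `k+1`. -/
abbrev Tm (X : TTS.{u}) (k : ℕ) : Type u := X.obj (op ((Paths.of Shape).obj (.tm k)))

/-- The boundary map `X(n+1) → X(n)`. -/
def bdTy (X : TTS.{u}) {k : ℕ} (A : X.Ty (k + 1)) : X.Ty k :=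
  X.map ((Paths.of Shape).map (Shape.Arrow.ext k)).op A

/-- The boundary map `X(n_t) → X(n)`. -/
def bdTm (X : TTS.{u}) {k : ℕ} (a : X.Tm k) : X.Ty k :=
  X.map ((Paths.of Shape).map (Shape.Arrow.bd k)).op a

/-- `Tm_X(A)`, the term-elements with boundary `A`. -/
def TmOver (X : TTS.{u}) {k : ℕ} (A : X.Ty k) : Type u := {a : X.Tm k // X.bdTm a = A}

/-- Action of a presheaf map on type-elements. -/
def appTy {X Y : TTS.{u}} (f : X ⟶ Y) {k : ℕ} (A : X.Ty k) : Y.Ty k := f.app _ A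

/-- Action of a presheaf map on term-elements. -/
def appTm {X Y : TTS.{u}} (f : X ⟶ Y) {k : ℕ} (a : X.Tm k) : Y.Tm k := f.app _ a

theorem appTy_bdTy {X Y : TTS.{u}} (f : X ⟶ Y) {k : ℕ} (A : X.Ty (k + 1)) :
    Y.bdTy (appTy f A) = appTy f (X.bdTy A) :=
  (NatTrans.naturality_apply f ((Paths.of Shape).map (Shape.Arrow.ext k)).op A).symm

theorem appTy_bdTm {X Y : TTS.{u}} (f : X ⟶ Y) {k : ℕ} (a : X.Tm k) :
    Y.bdTm (appTm f a) = appTy f (X.bdTm a) :=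
  (NatTrans.naturality_apply f ((Paths.of Shape).map (Shape.Arrow.bd k)).op a).symm

/-- The sets and boundary maps which determine a type-and-term structure. -/
structure Data : Type (u + 1) where
  ty : ℕ → Type u
  tm : ℕ → Type u
  bdTy : ∀ k, ty (k + 1) → ty k
  bdTm : ∀ k, tm k → ty k

/-- The value at an object of `H` of the presheaf determined by the data. -/
def Data.obj (P : Data.{u}) : Shape → Type u
  | .ty k => P.ty k
  | .tm k => P.tm k

/-- The value at a generating arrow of `H` of the presheaf determined by the data. -/
def Data.res (P : Data.{u}) : ∀ {a b : Shape}, Shape.Arrow a b → P.obj b → P.obj a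
  | _, _, .ext k => P.bdTy k
  | _, _, .bd k => P.bdTm k

/-- The presheaf on `H` determined by its sets of type- and term-elements and its boundary
maps. -/
def ofData (P : Data.{u}) : TTS.{u} :=
  (Paths.lift (V := Shape) (C := (Type u)ᵒᵖ)
    { obj := fun s => op (P.obj s)
      map := fun e => (TypeCat.ofHom (P.res e)).op }).leftOp

theorem ofData_bdTy (P : Data.{u}) {k : ℕ} (A : P.ty (k + 1)) :
    (ofData P).bdTy (k := k) A = P.bdTy k A := rfl

theorem ofData_bdTm (P : Data.{u}) {k : ℕ} (a : P.tm k) :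
    (ofData P).bdTm (k := k) a = P.bdTm k a := rfl

/-- The components at all objects of `H` of a family of maps on type- and term-elements. -/
def component {X Y : TTS.{u}} (f : ∀ k, X.Ty k → Y.Ty k) (g : ∀ k, X.Tm k → Y.Tm k) :
    ∀ s : Shape, X.obj (op s) → Y.obj (op s)
  | .ty k => f k
  | .tm k => g k

/-- A map of presheaves is given by maps on type- and term-elements that commute with the
boundary maps. -/
def homMk {X Y : TTS.{u}} (f : ∀ k, X.Ty k → Y.Ty k) (g : ∀ k, X.Tm k → Y.Tm k)
    (hf : ∀ k (A : X.Ty (k + 1)), Y.bdTy (f (k + 1) A) = f k (X.bdTy A))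
    (hg : ∀ k (a : X.Tm k), Y.bdTm (g k a) = f k (X.bdTm a)) : X ⟶ Y where
  app s := TypeCat.ofHom (component f g s.unop)
  naturality := by
    have step : ∀ {a b : Shape} (q : Shape.Arrow a b),
        X.map ((Paths.of Shape).map q).op ≫ TypeCat.ofHom (component f g a) =
          TypeCat.ofHom (component f g b) ≫ Y.map ((Paths.of Shape).map q).op := by
      intro a b q
      cases q with
      | ext k => ext A; exact (hf k A).symm
      | bd k => ext a; exact (hg k a).symm
    have key : ∀ {a b : HCat} (p : a ⟶ b),
        X.map p.op ≫ TypeCat.ofHom (component f g a) =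
          TypeCat.ofHom (component f g b) ≫ Y.map p.op := by
      intro a b p
      induction p using Paths.induction with
      | id =>
        rename_i v
        simp only [op_id, CategoryTheory.Functor.map_id]
        rfl
      | comp p q ih =>
        rw [op_comp, Functor.map_comp, Functor.map_comp, Category.assoc, ih, ← Category.assoc,
          ← Category.assoc]
        congr 1
        exact step q
    intro a b p
    exact key p.unop

theorem homMk_appTy {X Y : TTS.{u}} (f : ∀ k, X.Ty k → Y.Ty k) (g : ∀ k, X.Tm k → Y.Tm k)
    (hf hg) {k : ℕ} (A : X.Ty k) : appTy (homMk f g hf hg) A = f k A := rfl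

theorem homMk_appTm {X Y : TTS.{u}} (f : ∀ k, X.Ty k → Y.Ty k) (g : ∀ k, X.Tm k → Y.Tm k)
    (hf hg) {k : ℕ} (a : X.Tm k) : appTm (homMk f g hf hg) a = g k a := rfl

theorem hom_ext {X Y : TTS.{u}} {f g : X ⟶ Y} (h : ∀ k (A : X.Ty k), appTy f A = appTy g A)
    (h' : ∀ k (a : X.Tm k), appTm f a = appTm g a) : f = g := by
  ext s x
  match s, x with
  | ⟨.ty k⟩, A => exact h k A
  | ⟨.tm k⟩, a => exact h' k a

end TTS

/-! ## Syntax -/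

/-- Expressions over the alphabet `W`; the set of variables is `ℕ`. -/
inductive Expr (W : Type u) : Type u
  | var (x : ℕ) : Expr W
  | app (w : W) (n : ℕ) (e : Fin n → Expr W) : Expr W

namespace Expr

variable {W : Type u} {W' : Type v}

/-- The free variables of an expression. -/
def fv : Expr W → Set ℕ
  | var x => {x}
  | app _ _ e => {y | ∃ i, y ∈ (e i).fv}

/-- Simultaneous substitution of expressions for all variables. -/
def bind (s : ℕ → Expr W) : Expr W → Expr W
  | var x => s x
  | app w n e => app w n fun i => (e i).bind s

/-- The substitution `e[t/y]`. -/
def subst (e t : Expr W) (y : ℕ) : Expr W := e.bind (Function.update var y t)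

/-- The action of a permutation of the variables. -/
def perm (σ : Equiv.Perm ℕ) (e : Expr W) : Expr W := e.bind fun x => var (σ x)

/-- Relabelling of the symbols of the alphabet. -/
def relabel (g : W → W') : Expr W → Expr W'
  | var x => var x
  | app w n e => app (g w) n fun i => (e i).relabel g

theorem relabel_bind (g : W → W') (s : ℕ → Expr W) (e : Expr W) :
    (e.bind s).relabel g = (e.relabel g).bind fun x => (s x).relabel g := by
  induction e with
  | var x => rfl
  | app w n e ih => simp only [bind, relabel, ih]

theorem relabel_subst (g : W → W') (t : Expr W) (y : ℕ) (e : Expr W) :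
    (e.subst t y).relabel g = (e.relabel g).subst (t.relabel g) y := by
  unfold subst
  rw [relabel_bind]
  congr 1
  funext x
  by_cases h : x = y
  · subst h; simp
  · simp [Function.update_of_ne h, relabel]

theorem relabel_perm (g : W → W') (σ : Equiv.Perm ℕ) (e : Expr W) :
    (e.perm σ).relabel g = (e.relabel g).perm σ := by
  unfold perm; rw [relabel_bind]; rfl

theorem fv_relabel (g : W → W') (e : Expr W) : (e.relabel g).fv = e.fv := by
  induction e with
  | var x => rfl
  | app w n e ih => simp only [relabel, fv, ih]

theorem relabel_id (e : Expr W) : e.relabel (fun w => w) = e := by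
  induction e with
  | var x => rfl
  | app w n e ih => simp only [relabel, ih]

theorem relabel_relabel {W'' : Type*} (g : W → W') (g' : W' → W'') (e : Expr W) :
    (e.relabel g).relabel g' = e.relabel fun w => g' (g w) := by
  induction e with
  | var x => rfl
  | app w n e ih => simp only [relabel, ih]

end Expr

/-- A string of declarations `x : T`, listed with the last declaration first: the context
`Γ, y : T, Δ` is the list `Δ ++ (y, T) :: Γ`.  That the declared variables are distinct is
required of the basic judgements of a theory, and is then preserved by all deduction rules. -/
abbrev Ctx (W : Type u) : Type u := List (ℕ × Expr W)

/-- The right-hand sides of the four forms of judgement. -/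
inductive Body (W : Type u) : Type u
  | ty (T : Expr W)
  | tm (t T : Expr W)
  | tyEq (T T' : Expr W)
  | tmEq (t t' T : Expr W)

/-- Apply a function to all expressions in the right-hand side of a judgement. -/
def Body.map {W : Type u} {W' : Type v} (f : Expr W → Expr W') : Body W → Body W'
  | ty T => ty (f T)
  | tm t T => tm (f t) (f T)
  | tyEq T T' => tyEq (f T) (f T')
  | tmEq t t' T => tmEq (f t) (f t') (f T)

/-- Judgements `Γ ⊢ 𝒥`. -/
structure Judgement (W : Type u) : Type u where
  ctx : Ctx W
  body : Body W

namespace Ctx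

variable {W : Type u} {W' : Type v}

/-- The declared variables, last one first. -/
def vars (Γ : Ctx W) : List ℕ := Γ.map Prod.fst

/-- The variables that are declared or occur in a context. -/
def fv (Γ : Ctx W) : Set ℕ := {y | ∃ p ∈ Γ, y = p.1 ∨ y ∈ p.2.fv}

/-- The substitution `Δ[t/y]` in the types of a context. -/
def subst (t : Expr W) (y : ℕ) (Δ : Ctx W) : Ctx W := Δ.map fun p => (p.1, p.2.subst t y)

/-- The action of a permutation of the variables. -/
def perm (σ : Equiv.Perm ℕ) (Γ : Ctx W) : Ctx W := Γ.map fun p => (σ p.1, p.2.perm σ)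

/-- Relabelling of the symbols of the alphabet. -/
def relabel (g : W → W') (Γ : Ctx W) : Ctx W' := Γ.map fun p => (p.1, p.2.relabel g)

end Ctx

/-- Relabelling of the symbols of the alphabet. -/
def Judgement.relabel {W : Type u} {W' : Type v} (g : W → W') (J : Judgement W) : Judgement W' :=
  ⟨Ctx.relabel g J.ctx, J.body.map (Expr.relabel g)⟩

/-- The boundary of a judgement. -/
def Judgement.boundary {W : Type u} (J : Judgement W) : List (Judgement W) :=
  match J.body with
  | .ty _ =>
    match J.ctx with
    | [] => []
    | (_, T) :: Γ => [⟨Γ, .ty T⟩]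
  | .tm _ T => [⟨J.ctx, .ty T⟩]
  | .tyEq T T' => [⟨J.ctx, .ty T⟩, ⟨J.ctx, .ty T'⟩]
  | .tmEq t t' T => [⟨J.ctx, .tm t T⟩, ⟨J.ctx, .tm t' T⟩]

/-- The three optional groups of deduction rules: weakening, projection, substitution. -/
inductive Rule : Type
  | w
  | p
  | s

/-- The judgements derivable from the basic judgements `Λ` by the rules for equality, renaming of
variables, and the groups of rules in `D`.  A basic judgement may be used once all judgements in
its boundary have been derived. -/
inductive Derivable {W : Type u} (D : Set Rule) (Λ : Set (Judgement W)) : Judgement W → Prop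
  | basic (J : Judgement W) : J ∈ Λ → (∀ K ∈ J.boundary, Derivable D Λ K) → Derivable D Λ J
  | tm_refl (Γ : Ctx W) (t T : Expr W) :
      Derivable D Λ ⟨Γ, .tm t T⟩ → Derivable D Λ ⟨Γ, .tmEq t t T⟩
  | tm_symm (Γ : Ctx W) (t₁ t₂ T : Expr W) :
      Derivable D Λ ⟨Γ, .tmEq t₁ t₂ T⟩ → Derivable D Λ ⟨Γ, .tmEq t₂ t₁ T⟩
  | tm_trans (Γ : Ctx W) (t₁ t₂ t₃ T : Expr W) :
      Derivable D Λ ⟨Γ, .tmEq t₁ t₂ T⟩ → Derivable D Λ ⟨Γ, .tmEq t₂ t₃ T⟩ →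
      Derivable D Λ ⟨Γ, .tmEq t₁ t₃ T⟩
  | ty_refl (Γ : Ctx W) (T : Expr W) :
      Derivable D Λ ⟨Γ, .ty T⟩ → Derivable D Λ ⟨Γ, .tyEq T T⟩
  | ty_symm (Γ : Ctx W) (T₁ T₂ : Expr W) :
      Derivable D Λ ⟨Γ, .tyEq T₁ T₂⟩ → Derivable D Λ ⟨Γ, .tyEq T₂ T₁⟩
  | ty_trans (Γ : Ctx W) (T₁ T₂ T₃ : Expr W) :
      Derivable D Λ ⟨Γ, .tyEq T₁ T₂⟩ → Derivable D Λ ⟨Γ, .tyEq T₂ T₃⟩ →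
      Derivable D Λ ⟨Γ, .tyEq T₁ T₃⟩
  | tm_conv (Γ : Ctx W) (T₁ T₂ t : Expr W) :
      Derivable D Λ ⟨Γ, .tyEq T₁ T₂⟩ → Derivable D Λ ⟨Γ, .tm t T₁⟩ →
      Derivable D Λ ⟨Γ, .tm t T₂⟩
  | tmEq_conv (Γ : Ctx W) (T₁ T₂ t₁ t₂ : Expr W) :
      Derivable D Λ ⟨Γ, .tyEq T₁ T₂⟩ → Derivable D Λ ⟨Γ, .tmEq t₁ t₂ T₁⟩ →
      Derivable D Λ ⟨Γ, .tmEq t₁ t₂ T₂⟩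
  | alpha (σ : Equiv.Perm ℕ) (Γ : Ctx W) (𝒥 : Body W) :
      Derivable D Λ ⟨Γ, 𝒥⟩ → Derivable D Λ ⟨Γ.perm σ, 𝒥.map (Expr.perm σ)⟩
  | weakening (Γ Δ : Ctx W) (y : ℕ) (T : Expr W) (𝒥 : Body W) :
      Rule.w ∈ D → y ∉ Γ.fv → y ∉ Δ.fv →
      Derivable D Λ ⟨Γ, .ty T⟩ → Derivable D Λ ⟨Δ ++ Γ, 𝒥⟩ →
      Derivable D Λ ⟨Δ ++ (y, T) :: Γ, 𝒥⟩
  | projection (Γ : Ctx W) (y : ℕ) (T : Expr W) :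
      Rule.p ∈ D → y ∉ Γ.fv → Derivable D Λ ⟨Γ, .ty T⟩ →
      Derivable D Λ ⟨(y, T) :: Γ, .tm (.var y) T⟩
  | substitution (Γ Δ : Ctx W) (y : ℕ) (t T : Expr W) (𝒥 : Body W) :
      Rule.s ∈ D → Derivable D Λ ⟨Γ, .tm t T⟩ → Derivable D Λ ⟨Δ ++ (y, T) :: Γ, 𝒥⟩ →
      Derivable D Λ ⟨Δ.subst t y ++ Γ, 𝒥.map fun e => e.subst t y⟩
  | subst_tyEq (Γ Δ : Ctx W) (y : ℕ) (t₁ t₂ T T' : Expr W) :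
      Rule.s ∈ D → Derivable D Λ ⟨Γ, .tmEq t₁ t₂ T⟩ →
      Derivable D Λ ⟨Δ ++ (y, T) :: Γ, .ty T'⟩ →
      Derivable D Λ ⟨Δ.subst t₂ y ++ Γ, .tyEq (T'.subst t₁ y) (T'.subst t₂ y)⟩
  | subst_tmEq (Γ Δ : Ctx W) (y : ℕ) (t₁ t₂ T t' T' : Expr W) :
      Rule.s ∈ D → Derivable D Λ ⟨Γ, .tmEq t₁ t₂ T⟩ →
      Derivable D Λ ⟨Δ ++ (y, T) :: Γ, .tm t' T'⟩ →
      Derivable D Λ ⟨Δ.subst t₂ y ++ Γ,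
        .tmEq (t'.subst t₁ y) (t'.subst t₂ y) (T'.subst t₂ y)⟩

/-! ## Generalised algebraic theories -/

/-- `J` is of the form `x₁ : T₁, …, xₙ : Tₙ ⊢ c(x₁, …, xₙ) type`. -/
def Judgement.IntroducesTy {W : Type u} (c : W) (J : Judgement W) : Prop :=
  ∃ (n : ℕ) (x : Fin n → ℕ), J.ctx.vars = (List.ofFn x).reverse ∧
    J.body = .ty (.app c n fun i => .var (x i))

/-- `J` is of the form `x₁ : T₁, …, xₙ : Tₙ ⊢ c(x₁, …, xₙ) : T`. -/
def Judgement.IntroducesTm {W : Type u} (c : W) (J : Judgement W) : Prop :=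
  ∃ (n : ℕ) (x : Fin n → ℕ) (T : Expr W), J.ctx.vars = (List.ofFn x).reverse ∧
    J.body = .tm (.app c n fun i => .var (x i)) T

/-- `J` is a type equality or term equality judgement. -/
def Judgement.IsEquality {W : Type u} (J : Judgement W) : Prop :=
  (∃ T T', J.body = .tyEq T T') ∨ ∃ t t' T, J.body = .tmEq t t' T

/-- A `D`-GAT: type-constants, term-constants and basic judgements. -/
structure GAT (D : Set Rule) : Type (u + 1) where
  tyConst : Type u
  tmConst : Type u
  basic : Set (Judgement (tyConst ⊕ tmConst))
  nodup : ∀ J ∈ basic, J.ctx.vars.Nodup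
  tyAxiom : ∀ A : tyConst, ∃! J, J ∈ basic ∧ J.IntroducesTy (Sum.inl A)
  tmAxiom : ∀ f : tmConst, ∃! J, J ∈ basic ∧ J.IntroducesTm (Sum.inr f)
  eqAxiom : ∀ J ∈ basic, (∃ A, J.IntroducesTy (Sum.inl A)) ∨
    (∃ f, J.IntroducesTm (Sum.inr f)) ∨ J.IsEquality
  derivable : ∀ J ∈ basic, Derivable D basic J

namespace GAT

variable {D : Set Rule}

/-- The alphabet of a theory. -/
abbrev Sym (𝕋 : GAT.{u} D) : Type u := 𝕋.tyConst ⊕ 𝕋.tmConst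

/-- The derived judgements of a theory. -/
def Derives (𝕋 : GAT.{u} D) (J : Judgement 𝕋.Sym) : Prop := Derivable D 𝕋.basic J

/-- The boundary of a derived judgement consists of derived judgements. -/
def BoundaryClosed (𝕋 : GAT.{u} D) : Prop :=
  ∀ J, 𝕋.Derives J → ∀ K ∈ J.boundary, 𝕋.Derives K

end GAT

/-- The substitution `[x₁/y₁, …, xₙ/yₙ]`, where the `xᵢ` and the `yᵢ` are the declared variables of
two contexts. -/
def Ctx.ren {W : Type u} : Ctx W → Ctx W → ℕ → Expr W
  | (x, _) :: Γ, (y, _) :: Γ' => Function.update (Ctx.ren Γ Γ') y (.var x)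
  | _, _ => Expr.var

namespace GAT

variable {D : Set Rule}

/-- The congruence `(Γ ⊢ S type) ≡ (Γ' ⊢ T type)`: the contexts have the same length, and each
type of the first judgement is provably equal to the corresponding renamed type of the second. -/
def TyCongr (𝕋 : GAT.{u} D) : Ctx 𝕋.Sym → Expr 𝕋.Sym → Ctx 𝕋.Sym → Expr 𝕋.Sym → Prop
  | [], S, [], T => 𝕋.Derives ⟨[], .tyEq S T⟩
  | (x, S') :: Γ, S, (y, T') :: Γ', T => 𝕋.TyCongr Γ S' Γ' T' ∧
      𝕋.Derives ⟨(x, S') :: Γ, .tyEq S (T.bind (Ctx.ren ((x, S') :: Γ) ((y, T') :: Γ')))⟩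
  | [], _, _ :: _, _ => False
  | _ :: _, _, [], _ => False

/-- The congruence `(Γ ⊢ s : S) ≡ (Γ' ⊢ t : T)`. -/
def TmCongr (𝕋 : GAT.{u} D) (Γ : Ctx 𝕋.Sym) (s S : Expr 𝕋.Sym) (Γ' : Ctx 𝕋.Sym)
    (t T : Expr 𝕋.Sym) : Prop :=
  𝕋.TyCongr Γ S Γ' T ∧ 𝕋.Derives ⟨Γ, .tmEq s (t.bind (Ctx.ren Γ Γ')) S⟩

/-- Derived type judgements of degree `k+1`. -/
@[ext]
structure TyJ (𝕋 : GAT.{u} D) (k : ℕ) : Type u where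
  ctx : Ctx 𝕋.Sym
  ty : Expr 𝕋.Sym
  len : ctx.length = k
  der : 𝕋.Derives ⟨ctx, .ty ty⟩

/-- Derived term judgements of degree `k+1`. -/
@[ext]
structure TmJ (𝕋 : GAT.{u} D) (k : ℕ) : Type u where
  ctx : Ctx 𝕋.Sym
  tm : Expr 𝕋.Sym
  ty : Expr 𝕋.Sym
  len : ctx.length = k
  der : 𝕋.Derives ⟨ctx, .tm tm ty⟩

/-- The congruence of derived type judgements. -/
def TyJ.Rel (𝕋 : GAT.{u} D) {k : ℕ} (J K : 𝕋.TyJ k) : Prop := 𝕋.TyCongr J.ctx J.ty K.ctx K.ty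

/-- The congruence of derived term judgements. -/
def TmJ.Rel (𝕋 : GAT.{u} D) {k : ℕ} (J K : 𝕋.TmJ k) : Prop :=
  𝕋.TmCongr J.ctx J.tm J.ty K.ctx K.tm K.ty

/-- The boundary of a derived type judgement `Γ, x : T ⊢ T' type`. -/
def TyJ.bd {𝕋 : GAT.{u} D} (h : 𝕋.BoundaryClosed) {k : ℕ} : 𝕋.TyJ (k + 1) → 𝕋.TyJ k
  | ⟨(_, T) :: Γ, _, len, der⟩ => ⟨Γ, T, Nat.succ.inj len, h _ der _ (List.mem_singleton.2 rfl)⟩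

/-- The boundary of a derived term judgement. -/
def TmJ.bd {𝕋 : GAT.{u} D} (h : 𝕋.BoundaryClosed) {k : ℕ} (J : 𝕋.TmJ k) : 𝕋.TyJ k :=
  ⟨J.ctx, J.ty, J.len, h _ J.der _ (List.mem_singleton.2 rfl)⟩

theorem TyJ.bd_rel {𝕋 : GAT.{u} D} (h : 𝕋.BoundaryClosed) {k : ℕ} (J K : 𝕋.TyJ (k + 1))
    (r : TyJ.Rel 𝕋 J K) : TyJ.Rel 𝕋 (J.bd h) (K.bd h) := by
  match J, K, r with
  | ⟨(_, _) :: _, _, _, _⟩, ⟨(_, _) :: _, _, _, _⟩, r => exact r.1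

/-- The type-and-term structure `V𝕋` of derived type and term judgements modulo the congruence. -/
def toTTS (𝕋 : GAT.{u} D) (h : 𝕋.BoundaryClosed) : TTS.{u} :=
  TTS.ofData
    { ty := fun k => Quot (TyJ.Rel 𝕋 (k := k))
      tm := fun k => Quot (TmJ.Rel 𝕋 (k := k))
      bdTy := fun _ => Quot.map (TyJ.bd h) (TyJ.bd_rel h)
      bdTm := fun _ => Quot.map (TmJ.bd h) fun _ _ r => r.1 }

end GAT

/-! ## The free theory on a type-and-term structure -/

namespace Free

variable (X : TTS.{u})

/-- The alphabet of the free theory: the type-elements and the term-elements of `X`. -/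
abbrev Sym : Type u := (Σ k, X.Ty k) ⊕ (Σ k, X.Tm k)

variable {X}

/-- The expression `A(x₁, …, x_{n-1})`; the variable `xᵢ₊₁` is `i`. -/
def tyExpr {k : ℕ} (A : X.Ty k) : Expr (Sym X) := .app (.inl ⟨k, A⟩) k fun i => .var i

/-- The expression `a(x₁, …, x_{n-1})`. -/
def tmExpr {k : ℕ} (a : X.Tm k) : Expr (Sym X) := .app (.inr ⟨k, a⟩) k fun i => .var i

/-- The context `x₁ : A₁, …, x_{n-1} : A_{n-1}(x₁, …, x_{n-2})` of successive boundaries of `A`. -/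
def ctx : ∀ (k : ℕ), X.Ty k → Ctx (Sym X)
  | 0, _ => []
  | k + 1, A => (k, tyExpr (X.bdTy A)) :: ctx k (X.bdTy A)

/-- The basic judgement `x₁ : A₁, …, x_{n-1} : A_{n-1}(x₁, …, x_{n-2}) ⊢ A(x₁, …, x_{n-1}) type`. -/
def tyJudgement {k : ℕ} (A : X.Ty k) : Judgement (Sym X) := ⟨ctx k A, .ty (tyExpr A)⟩

/-- The basic judgement
`x₁ : A₁, …, x_{n-1} : A_{n-1}(x₁, …, x_{n-2}) ⊢ a(x₁, …, x_{n-1}) : A(x₁, …, x_{n-1})`, where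
`A` is the boundary of `a`. -/
def tmJudgement {k : ℕ} (a : X.Tm k) : Judgement (Sym X) :=
  ⟨ctx k (X.bdTm a), .tm (tmExpr a) (tyExpr (X.bdTm a))⟩

variable (X) in
/-- The basic judgements of the free theory. -/
def basic : Set (Judgement (Sym X)) :=
  {J | (∃ (k : ℕ) (A : X.Ty k), J = tyJudgement A) ∨ ∃ (k : ℕ) (a : X.Tm k), J = tmJudgement a}

theorem ctx_vars {k : ℕ} (A : X.Ty k) :
    (ctx k A).vars = (List.ofFn fun i : Fin k => (i : ℕ)).reverse := by
  induction k with
  | zero => rfl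
  | succ k ih =>
    rw [List.ofFn_succ']
    simp only [List.concat_eq_append, List.reverse_append, List.reverse_cons, List.reverse_nil,
      List.nil_append, List.singleton_append, Fin.val_last, Fin.val_castSucc]
    rw [← ih (X.bdTy A)]
    rfl

theorem ctx_length {k : ℕ} (A : X.Ty k) : (ctx k A).length = k := by
  induction k with
  | zero => rfl
  | succ k ih => simp [ctx, ih]

theorem ctx_nodup {k : ℕ} (A : X.Ty k) : (ctx k A).vars.Nodup := by
  rw [ctx_vars, List.nodup_reverse, List.nodup_ofFn]
  exact Fin.val_injective

theorem derivable_ty (D : Set Rule) {k : ℕ} (A : X.Ty k) :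
    Derivable D (basic X) (tyJudgement A) := by
  induction k with
  | zero =>
    refine .basic _ (Or.inl ⟨_, A, rfl⟩) fun K hK => ?_
    cases hK
  | succ k ih =>
    refine .basic _ (Or.inl ⟨_, A, rfl⟩) fun K hK => ?_
    obtain rfl : K = tyJudgement (X.bdTy A) := List.mem_singleton.1 hK
    exact ih _

theorem derivable_tm (D : Set Rule) {k : ℕ} (a : X.Tm k) :
    Derivable D (basic X) (tmJudgement a) := by
  refine .basic _ (Or.inr ⟨_, a, rfl⟩) fun K hK => ?_
  obtain rfl : K = tyJudgement (X.bdTm a) := List.mem_singleton.1 hK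
  exact derivable_ty D _

end Free

/-- The free `D`-GAT on `X`. -/
abbrev freeGAT (D : Set Rule) (X : TTS.{u}) : GAT.{u} D where
  tyConst := Σ k, X.Ty k
  tmConst := Σ k, X.Tm k
  basic := Free.basic X
  nodup := by
    rintro J (⟨k, A, rfl⟩ | ⟨k, a, rfl⟩) <;> exact Free.ctx_nodup _
  tyAxiom := by
    rintro ⟨k, A⟩
    refine ⟨Free.tyJudgement A, ⟨Or.inl ⟨k, A, rfl⟩, k, fun i => i, Free.ctx_vars A, rfl⟩, ?_⟩
    rintro J ⟨⟨l, B, rfl⟩ | ⟨l, b, rfl⟩, n, x, _, hJ⟩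
    · simp only [Free.tyJudgement, Free.tyExpr, Body.ty.injEq, Expr.app.injEq, Sum.inl.injEq] at hJ
      obtain ⟨h, _⟩ := hJ
      cases h
      rfl
    · cases hJ
  tmAxiom := by
    rintro ⟨k, a⟩
    refine ⟨Free.tmJudgement a,
      ⟨Or.inr ⟨k, a, rfl⟩, k, fun i => i, _, Free.ctx_vars _, rfl⟩, ?_⟩
    rintro J ⟨⟨l, B, rfl⟩ | ⟨l, b, rfl⟩, n, x, T, _, hJ⟩
    · cases hJ
    · simp only [Free.tmJudgement, Free.tmExpr, Body.tm.injEq, Expr.app.injEq, Sum.inr.injEq] at hJ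
      obtain ⟨⟨h, _⟩, _⟩ := hJ
      cases h
      rfl
  eqAxiom := by
    rintro J (⟨k, A, rfl⟩ | ⟨k, a, rfl⟩)
    · exact Or.inl ⟨⟨k, A⟩, k, fun i => i, Free.ctx_vars A, rfl⟩
    · exact Or.inr (Or.inl ⟨⟨k, a⟩, k, fun i => i, _, Free.ctx_vars _, rfl⟩)
  derivable := by
    rintro J (⟨k, A, rfl⟩ | ⟨k, a, rfl⟩)
    · exact Free.derivable_ty D A
    · exact Free.derivable_tm D a

/-! ### Boundaries of derived judgements in the free `{s}`-GAT -/

namespace Free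

variable {X : TTS.{u}}

/-- All types of the context are derived. -/
def WfCtx (X : TTS.{u}) : Ctx (Sym X) → Prop
  | [] => True
  | (_, T) :: Γ => Derivable {Rule.s} (basic X) ⟨Γ, .ty T⟩ ∧ WfCtx X Γ

/-- The strengthened induction hypothesis on right-hand sides. -/
def WfBody (X : TTS.{u}) (Γ : Ctx (Sym X)) : Body (Sym X) → Prop
  | .ty _ => True
  | .tm _ T => Derivable {Rule.s} (basic X) ⟨Γ, .ty T⟩
  | .tyEq T T' => T = T' ∧ Derivable {Rule.s} (basic X) ⟨Γ, .ty T⟩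
  | .tmEq t t' T => t = t' ∧ Derivable {Rule.s} (basic X) ⟨Γ, .tm t T⟩ ∧
      Derivable {Rule.s} (basic X) ⟨Γ, .ty T⟩

theorem WfCtx.perm (σ : Equiv.Perm ℕ) : ∀ {Γ : Ctx (Sym X)}, WfCtx X Γ → WfCtx X (Γ.perm σ)
  | [], _ => trivial
  | (_, _) :: _, h => ⟨.alpha σ _ _ h.1, WfCtx.perm σ h.2⟩

theorem WfCtx.subst {Γ : Ctx (Sym X)} {y : ℕ} {t T : Expr (Sym X)}
    (ht : Derivable {Rule.s} (basic X) ⟨Γ, .tm t T⟩) :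
    ∀ {Δ : Ctx (Sym X)}, WfCtx X (Δ ++ (y, T) :: Γ) → WfCtx X (Δ.subst t y ++ Γ)
  | [], h => h.2
  | (_, _) :: Δ, h =>
    ⟨.substitution Γ Δ y t T _ (Set.mem_singleton _) ht h.1, WfCtx.subst ht (Δ := Δ) h.2⟩

theorem wf {J : Judgement (Sym X)} (hJ : Derivable {Rule.s} (basic X) J) :
    WfCtx X J.ctx ∧ WfBody X J.ctx J.body := by
  induction hJ with
  | basic J hJ h ih =>
    rcases hJ with ⟨k, A, rfl⟩ | ⟨k, a, rfl⟩
    · refine ⟨?_, trivial⟩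
      cases k with
      | zero => trivial
      | succ k => exact ⟨h _ (List.mem_singleton.2 rfl), (ih _ (List.mem_singleton.2 rfl)).1⟩
    · exact ⟨(ih _ (List.mem_singleton.2 rfl)).1, h _ (List.mem_singleton.2 rfl)⟩
  | tm_refl Γ t T h ih => exact ⟨ih.1, rfl, h, ih.2⟩
  | tm_symm Γ t₁ t₂ T h ih =>
    obtain ⟨hc, rfl, hb⟩ := ih
    exact ⟨hc, rfl, hb⟩
  | tm_trans Γ t₁ t₂ t₃ T h h' ih ih' =>
    obtain ⟨hc, rfl, hb⟩ := ih
    obtain ⟨_, rfl, _⟩ := ih'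
    exact ⟨hc, rfl, hb⟩
  | ty_refl Γ T h ih => exact ⟨ih.1, rfl, h⟩
  | ty_symm Γ T₁ T₂ h ih =>
    obtain ⟨hc, rfl, hb⟩ := ih
    exact ⟨hc, rfl, hb⟩
  | ty_trans Γ T₁ T₂ T₃ h h' ih ih' =>
    obtain ⟨hc, rfl, hb⟩ := ih
    obtain ⟨_, rfl, _⟩ := ih'
    exact ⟨hc, rfl, hb⟩
  | tm_conv Γ T₁ T₂ t h h' ih ih' =>
    obtain ⟨_, rfl, _⟩ := ih
    exact ih'
  | tmEq_conv Γ T₁ T₂ t₁ t₂ h h' ih ih' =>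
    obtain ⟨_, rfl, _⟩ := ih
    exact ih'
  | alpha σ Γ 𝒥 h ih =>
    refine ⟨ih.1.perm σ, ?_⟩
    obtain ⟨_, hb⟩ := ih
    cases 𝒥 with
    | ty T => trivial
    | tm t T => exact .alpha σ _ _ hb
    | tyEq T T' => exact ⟨congrArg _ hb.1, .alpha σ _ _ hb.2⟩
    | tmEq t t' T => exact ⟨congrArg _ hb.1, .alpha σ _ _ hb.2.1, .alpha σ _ _ hb.2.2⟩
  | weakening Γ Δ y T 𝒥 hw => cases hw
  | projection Γ y T hp => cases hp
  | substitution Γ Δ y t T 𝒥 hs ht h iht ih =>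
    refine ⟨WfCtx.subst ht ih.1, ?_⟩
    obtain ⟨_, hb⟩ := ih
    cases 𝒥 with
    | ty T' => trivial
    | tm t' T' => exact .substitution _ _ _ _ _ _ hs ht hb
    | tyEq T' T'' => exact ⟨congrArg (Expr.subst · t y) hb.1, .substitution _ _ _ _ _ _ hs ht hb.2⟩
    | tmEq t' t'' T' =>
      exact ⟨congrArg (Expr.subst · t y) hb.1, .substitution _ _ _ _ _ _ hs ht hb.2.1,
        .substitution _ _ _ _ _ _ hs ht hb.2.2⟩
  | subst_tyEq Γ Δ y t₁ t₂ T T' hs ht h iht ih =>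
    obtain ⟨_, rfl, ht', _⟩ := iht
    exact ⟨WfCtx.subst ht' ih.1, rfl, .substitution _ _ _ _ _ _ hs ht' h⟩
  | subst_tmEq Γ Δ y t₁ t₂ T t' T' hs ht h iht ih =>
    obtain ⟨_, rfl, ht', _⟩ := iht
    exact ⟨WfCtx.subst ht' ih.1, rfl, .substitution _ _ _ _ _ _ hs ht' h,
      .substitution _ _ _ _ _ _ hs ht' ih.2⟩

theorem boundaryClosed (X : TTS.{u}) : (freeGAT {Rule.s} X).BoundaryClosed := by
  intro J hJ K hK
  have h := wf (X := X) hJ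
  obtain ⟨Γ, 𝒥⟩ := J
  cases 𝒥 with
  | ty T =>
    match Γ, h, hK with
    | (_, S) :: Γ, h, hK =>
      obtain rfl : K = ⟨Γ, .ty S⟩ := List.mem_singleton.1 hK
      exact h.1.1
  | tm t T =>
    obtain rfl : K = ⟨Γ, .ty T⟩ := List.mem_singleton.1 hK
    exact h.2
  | tyEq T T' =>
    obtain ⟨_, rfl, h⟩ := h
    have hK' : K = ⟨Γ, .ty T⟩ := by simpa [Judgement.boundary] using hK
    subst hK'
    exact h
  | tmEq t t' T =>
    obtain ⟨_, rfl, h, _⟩ := h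
    have hK' : K = ⟨Γ, .tm t T⟩ := by simpa [Judgement.boundary] using hK
    subst hK'
    exact h

end Free

/-! ### Relabelling derived judgements -/

theorem Ctx.relabel_append {W : Type u} {W' : Type v} (g : W → W') (Γ Δ : Ctx W) :
    Ctx.relabel g (Δ ++ Γ) = Ctx.relabel g Δ ++ Ctx.relabel g Γ := List.map_append

theorem Ctx.relabel_subst {W : Type u} {W' : Type v} (g : W → W') (t : Expr W) (y : ℕ)
    (Δ : Ctx W) : (Δ.subst t y).relabel g = (Δ.relabel g).subst (t.relabel g) y := by
  simp [Ctx.relabel, Ctx.subst, Expr.relabel_subst]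

theorem Ctx.relabel_perm {W : Type u} {W' : Type v} (g : W → W') (σ : Equiv.Perm ℕ)
    (Γ : Ctx W) : (Γ.perm σ).relabel g = (Γ.relabel g).perm σ := by
  simp [Ctx.relabel, Ctx.perm, Expr.relabel_perm]

theorem Ctx.fv_relabel {W : Type u} {W' : Type v} (g : W → W') (Γ : Ctx W) :
    (Γ.relabel g).fv = Γ.fv := by
  ext y
  simp [Ctx.relabel, Ctx.fv, Expr.fv_relabel]

theorem Body.map_relabel_comm {W : Type u} {W' : Type v} (g : W → W') (f : Expr W → Expr W)
    (f' : Expr W' → Expr W') (h : ∀ e, (f e).relabel g = f' (e.relabel g)) (𝒥 : Body W) :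
    (𝒥.map f).map (Expr.relabel g) = (𝒥.map (Expr.relabel g)).map f' := by
  cases 𝒥 <;> simp [Body.map, h]

theorem Judgement.boundary_relabel {W : Type u} {W' : Type v} (g : W → W') (J : Judgement W) :
    (J.relabel g).boundary = J.boundary.map (Judgement.relabel g) := by
  obtain ⟨Γ, 𝒥⟩ := J
  cases 𝒥 with
  | ty T => cases Γ <;> rfl
  | tm t T => rfl
  | tyEq T T' => rfl
  | tmEq t t' T => rfl

theorem Derivable.relabel {W : Type u} {W' : Type v} {D : Set Rule} {Λ : Set (Judgement W)}
    {Λ' : Set (Judgement W')} (g : W → W') (hΛ : ∀ J ∈ Λ, J.relabel g ∈ Λ') {J : Judgement W}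
    (hJ : Derivable D Λ J) : Derivable D Λ' (J.relabel g) := by
  induction hJ with
  | basic J hJ h ih =>
    refine .basic _ (hΛ J hJ) fun K hK => ?_
    rw [Judgement.boundary_relabel, List.mem_map] at hK
    obtain ⟨K, hK, rfl⟩ := hK
    exact ih K hK
  | tm_refl Γ t T h ih => exact .tm_refl _ _ _ ih
  | tm_symm Γ t₁ t₂ T h ih => exact .tm_symm _ _ _ _ ih
  | tm_trans Γ t₁ t₂ t₃ T h h' ih ih' => exact .tm_trans _ _ _ _ _ ih ih'
  | ty_refl Γ T h ih => exact .ty_refl _ _ ih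
  | ty_symm Γ T₁ T₂ h ih => exact .ty_symm _ _ _ ih
  | ty_trans Γ T₁ T₂ T₃ h h' ih ih' => exact .ty_trans _ _ _ _ ih ih'
  | tm_conv Γ T₁ T₂ t h h' ih ih' => exact .tm_conv _ _ _ _ ih ih'
  | tmEq_conv Γ T₁ T₂ t₁ t₂ h h' ih ih' => exact .tmEq_conv _ _ _ _ _ ih ih'
  | alpha σ Γ 𝒥 h ih =>
    have := Derivable.alpha σ _ _ ih
    simp only [Judgement.relabel]
    rw [Ctx.relabel_perm, Body.map_relabel_comm g _ _ (Expr.relabel_perm g σ)]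
    exact this
  | weakening Γ Δ y T 𝒥 hw hΓ hΔ h h' ih ih' =>
    simp only [Judgement.relabel, Ctx.relabel_append] at ih' ⊢
    exact .weakening (Ctx.relabel g Γ) (Ctx.relabel g Δ) y (T.relabel g) _ hw
      (by rwa [Ctx.fv_relabel]) (by rwa [Ctx.fv_relabel]) ih ih'
  | projection Γ y T hp hΓ h ih =>
    exact .projection (Ctx.relabel g Γ) y (T.relabel g) hp (by rwa [Ctx.fv_relabel]) ih
  | substitution Γ Δ y t T 𝒥 hs ht h iht ih =>
    simp only [Judgement.relabel, Ctx.relabel_append, Ctx.relabel_subst] at ih ⊢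
    rw [Body.map_relabel_comm g _ _ fun e => Expr.relabel_subst g t y e]
    exact .substitution _ _ _ _ _ _ hs iht ih
  | subst_tyEq Γ Δ y t₁ t₂ T T' hs ht h iht ih =>
    simp only [Judgement.relabel, Ctx.relabel_append, Ctx.relabel_subst, Body.map,
      Expr.relabel_subst] at ih ⊢
    exact .subst_tyEq _ _ _ _ _ _ _ hs iht ih
  | subst_tmEq Γ Δ y t₁ t₂ T t' T' hs ht h iht ih =>
    simp only [Judgement.relabel, Ctx.relabel_append, Ctx.relabel_subst, Body.map,
      Expr.relabel_subst] at ih ⊢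
    exact .subst_tmEq _ _ _ _ _ _ _ _ hs iht ih

theorem Ctx.ren_relabel {W : Type u} {W' : Type v} (g : W → W') :
    ∀ (Γ Γ' : Ctx W) (z : ℕ),
      (Ctx.ren Γ Γ' z).relabel g = Ctx.ren (Γ.relabel g) (Γ'.relabel g) z
  | (x, _) :: Γ, (y, _) :: Γ', z => by
    have ih := Ctx.ren_relabel g Γ Γ' z
    simp only [Ctx.relabel, List.map_cons, Ctx.ren] at ih ⊢
    by_cases h : z = y
    · subst h; simp [Expr.relabel]
    · simp [Function.update_of_ne h, ih]
  | [], [], _ => rfl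
  | [], _ :: _, _ => rfl
  | _ :: _, [], _ => rfl

namespace Free

variable {X Y : TTS.{u}}

/-- The map of alphabets induced by a map of type-and-term structures. -/
def symMap (f : X ⟶ Y) : Sym X → Sym Y :=
  Sum.map (Sigma.map id fun _ => TTS.appTy f) (Sigma.map id fun _ => TTS.appTm f)

theorem symMap_id : symMap (𝟙 X) = fun w => w := by
  funext w
  rcases w with ⟨k, A⟩ | ⟨k, a⟩ <;> rfl

theorem symMap_comp {Z : TTS.{u}} (f : X ⟶ Y) (g : Y ⟶ Z) :
    symMap (f ≫ g) = fun w => symMap g (symMap f w) := by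
  funext w
  rcases w with ⟨k, A⟩ | ⟨k, a⟩ <;> rfl

theorem ctx_relabel (f : X ⟶ Y) {k : ℕ} (A : X.Ty k) :
    (ctx k A).relabel (symMap f) = ctx k (TTS.appTy f A) := by
  induction k with
  | zero => rfl
  | succ k ih =>
    have := ih (X.bdTy A)
    rw [← TTS.appTy_bdTy] at this
    simp only [Ctx.relabel] at this
    simp only [ctx, Ctx.relabel, List.map_cons, this, TTS.appTy_bdTy]
    rfl

theorem basic_relabel (f : X ⟶ Y) (J : Judgement (Sym X)) (hJ : J ∈ basic X) :
    J.relabel (symMap f) ∈ basic Y := by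
  rcases hJ with ⟨k, A, rfl⟩ | ⟨k, a, rfl⟩
  · refine Or.inl ⟨k, TTS.appTy f A, ?_⟩
    simp only [tyJudgement, Judgement.relabel, ctx_relabel]
    rfl
  · refine Or.inr ⟨k, TTS.appTm f a, ?_⟩
    simp only [tmJudgement, Judgement.relabel, ctx_relabel, TTS.appTy_bdTm]
    rfl

theorem derives_relabel (f : X ⟶ Y) {J : Judgement (Sym X)}
    (hJ : (freeGAT {Rule.s} X).Derives J) :
    (freeGAT {Rule.s} Y).Derives (J.relabel (symMap f)) :=
  Derivable.relabel (symMap f) (basic_relabel f) hJ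

theorem tyCongr_relabel (f : X ⟶ Y) :
    ∀ {Γ : Ctx (Sym X)} {S : Expr (Sym X)} {Γ' : Ctx (Sym X)} {T : Expr (Sym X)},
      (freeGAT {Rule.s} X).TyCongr Γ S Γ' T →
      (freeGAT {Rule.s} Y).TyCongr (Γ.relabel (symMap f)) (S.relabel (symMap f))
        (Γ'.relabel (symMap f)) (T.relabel (symMap f))
  | [], _, [], _, h => derives_relabel f h
  | (_, _) :: Γ, S, (_, _) :: Γ', T, h => by
    refine ⟨tyCongr_relabel f h.1, ?_⟩
    have := derives_relabel f h.2
    simp only [Judgement.relabel, Body.map] at this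
    rw [Expr.relabel_bind, funext (Ctx.ren_relabel (symMap f) _ _)] at this
    exact this

theorem tmCongr_relabel (f : X ⟶ Y) {Γ : Ctx (Sym X)} {s S : Expr (Sym X)} {Γ' : Ctx (Sym X)}
    {t T : Expr (Sym X)} (h : (freeGAT {Rule.s} X).TmCongr Γ s S Γ' t T) :
    (freeGAT {Rule.s} Y).TmCongr (Γ.relabel (symMap f)) (s.relabel (symMap f))
      (S.relabel (symMap f)) (Γ'.relabel (symMap f)) (t.relabel (symMap f))
      (T.relabel (symMap f)) := by
  refine ⟨tyCongr_relabel f h.1, ?_⟩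
  have := derives_relabel f h.2
  simp only [Judgement.relabel, Body.map] at this
  rw [Expr.relabel_bind, funext (Ctx.ren_relabel (symMap f) _ _)] at this
  exact this

/-- Relabelling of derived type judgements along `f`. -/
def mapTyJ (f : X ⟶ Y) {k : ℕ} (J : (freeGAT {Rule.s} X).TyJ k) : (freeGAT {Rule.s} Y).TyJ k where
  ctx := Ctx.relabel (symMap f) J.ctx
  ty := J.ty.relabel (symMap f)
  len := (List.length_map _).trans J.len
  der := derives_relabel f J.der

/-- Relabelling of derived term judgements along `f`. -/
def mapTmJ (f : X ⟶ Y) {k : ℕ} (J : (freeGAT {Rule.s} X).TmJ k) : (freeGAT {Rule.s} Y).TmJ k where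
  ctx := Ctx.relabel (symMap f) J.ctx
  tm := J.tm.relabel (symMap f)
  ty := J.ty.relabel (symMap f)
  len := (List.length_map _).trans J.len
  der := derives_relabel f J.der

theorem mapTyJ_bd (f : X ⟶ Y) {k : ℕ} (J : (freeGAT {Rule.s} X).TyJ (k + 1)) :
    (mapTyJ f J).bd (boundaryClosed Y) = mapTyJ f (J.bd (boundaryClosed X)) := by
  match J with
  | ⟨(_, _) :: _, _, _, _⟩ => rfl

theorem mapTyJ_id {k : ℕ} (J : (freeGAT {Rule.s} X).TyJ k) : mapTyJ (𝟙 X) J = J := by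
  ext1 <;> simp [mapTyJ, symMap_id, Ctx.relabel, Expr.relabel_id]

theorem mapTmJ_id {k : ℕ} (J : (freeGAT {Rule.s} X).TmJ k) : mapTmJ (𝟙 X) J = J := by
  ext1 <;> simp [mapTmJ, symMap_id, Ctx.relabel, Expr.relabel_id]

theorem mapTyJ_comp {Z : TTS.{u}} (f : X ⟶ Y) (g : Y ⟶ Z) {k : ℕ}
    (J : (freeGAT {Rule.s} X).TyJ k) : mapTyJ (f ≫ g) J = mapTyJ g (mapTyJ f J) := by
  ext1 <;> simp [mapTyJ, symMap_comp, Ctx.relabel, Expr.relabel_relabel]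

theorem mapTmJ_comp {Z : TTS.{u}} (f : X ⟶ Y) (g : Y ⟶ Z) {k : ℕ}
    (J : (freeGAT {Rule.s} X).TmJ k) : mapTmJ (f ≫ g) J = mapTmJ g (mapTmJ f J) := by
  ext1 <;> simp [mapTmJ, symMap_comp, Ctx.relabel, Expr.relabel_relabel]

end Free

/-- The underlying endofunctor `S` of the substitution monad: `SX` is the type-and-term structure
of the free `{s}`-GAT on `X`, and `Sf` relabels the constants along `f`. -/
def substFunctor : TTS.{u} ⥤ TTS.{u} where
  obj X := (freeGAT {Rule.s} X).toTTS (Free.boundaryClosed X)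
  map {X Y} f := TTS.homMk
    (X := (freeGAT {Rule.s} X).toTTS (Free.boundaryClosed X))
    (Y := (freeGAT {Rule.s} Y).toTTS (Free.boundaryClosed Y))
    (fun _ => Quot.map (Free.mapTyJ f) fun _ _ => Free.tyCongr_relabel f)
    (fun _ => Quot.map (Free.mapTmJ f) fun _ _ => Free.tmCongr_relabel f)
    (fun _ => Quot.ind fun J =>
      congrArg (Quot.mk _) (Free.mapTyJ_bd f J))
    (fun _ => Quot.ind fun _ => rfl)
  map_id _ := TTS.hom_ext
    (fun _ => Quot.ind fun J =>
      congrArg (Quot.mk _) (Free.mapTyJ_id J))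
    (fun _ => Quot.ind fun J =>
      congrArg (Quot.mk _) (Free.mapTmJ_id J))
  map_comp f g := TTS.hom_ext
    (fun _ => Quot.ind fun J =>
      congrArg (Quot.mk _) (Free.mapTyJ_comp f g J))
    (fun _ => Quot.ind fun J =>
      congrArg (Quot.mk _) (Free.mapTmJ_comp f g J))

/-! ## Inc-lists -/

/-- Inc-lists of length `n`: strictly increasing functions `α : [0, n] → ℕ` with `α 0 = 0`. -/
@[ext]
structure Inc (n : ℕ) : Type where
  val : Fin (n + 1) → ℕ
  zero : val 0 = 0
  mono : StrictMono val

namespace Inc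

/-- The value `α(n)`. -/
def last {n : ℕ} (α : Inc n) : ℕ := α.val (Fin.last n)

/-- The restriction `∂α` of `α` to `[0, n]`. -/
def bd {n : ℕ} (α : Inc (n + 1)) : Inc n where
  val i := α.val i.castSucc
  zero := α.zero
  mono _ _ h := α.mono (Fin.castSucc_lt_castSucc_iff.2 h)

theorem bd_last_lt {n : ℕ} (α : Inc (n + 1)) : α.bd.last < α.last :=
  α.mono (Fin.castSucc_lt_last _)

theorem last_pos {n : ℕ} (α : Inc (n + 1)) : 0 < α.last := (Nat.zero_le _).trans_lt α.bd_last_lt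

/-- The type-and-term structure `[α]`: one type-element of each degree `i ≤ α(n)`, and one
term-element of each degree `i ≤ α(n)` not in the image of `α`.  The degree is `i+1` below. -/
def shape {n : ℕ} (α : Inc n) : TTS.{u} :=
  TTS.ofData
    { ty := fun i => ULift.{u} (PLift (i + 1 ≤ α.last))
      tm := fun i => ULift.{u} (PLift (i + 1 ≤ α.last ∧ i + 1 ∉ Set.range α.val))
      bdTy := fun _ h => ⟨⟨(Nat.le_succ _).trans h.down.down⟩⟩
      bdTm := fun _ h => ⟨⟨h.down.down.1⟩⟩ }

/-- The type-element `α(n)` of `[α]`, for `n > 0`; it has degree `α(n)`. -/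
def top {n : ℕ} (α : Inc (n + 1)) : (α.shape : TTS.{u}).Ty (α.last - 1) :=
  ULift.up (PLift.up (Nat.sub_add_cancel α.last_pos).le)

theorem notMem_range {n : ℕ} (α : Inc (n + 1)) {i : ℕ} (h : i ≤ α.bd.last)
    (h' : i ∉ Set.range α.bd.val) : i ∉ Set.range α.val := by
  rintro ⟨j, rfl⟩
  induction j using Fin.lastCases with
  | last => exact absurd α.bd_last_lt (not_lt.2 h)
  | cast j => exact h' ⟨j, rfl⟩

/-- The inclusion `[∂α] → [α]`. -/
def incl {n : ℕ} (α : Inc (n + 1)) : (α.bd.shape : TTS.{u}) ⟶ α.shape :=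
  TTS.homMk (X := α.bd.shape) (Y := α.shape)
    (fun _ h => ⟨⟨h.down.down.trans α.bd_last_lt.le⟩⟩)
    (fun _ h => ⟨⟨h.down.down.1.trans α.bd_last_lt.le, α.notMem_range h.down.down.1 h.down.down.2⟩⟩)
    (fun _ _ => rfl) (fun _ _ => rfl)

end Inc

/-- The type-and-term structure with type-elements of degree `n` the pairs of an inc-list `α` of
length `n` and a map `h : [α] → X`, with boundary `(∂α, ∂h)`, where `∂h` is the restriction of `h`
to `[∂α]`, and with the term-elements of `X` over `h(α(n))` as term-elements over `(α, h)`. -/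
def incObj (X : TTS.{u}) : TTS.{u} :=
  TTS.ofData
    { ty := fun k => Σ α : Inc (k + 1), (α.shape ⟶ X)
      tm := fun k => Σ p : (Σ α : Inc (k + 1), (α.shape ⟶ X)), X.TmOver (TTS.appTy p.2 p.1.top)
      bdTy := fun _ p => ⟨p.1.bd, p.1.incl ≫ p.2⟩
      bdTm := fun _ a => a.1 }

/-- The functor `X ↦ incObj X`; a map `f` acts by composition on type-elements and by `f` on
term-elements. -/
def incFunctor : TTS.{u} ⥤ TTS.{u} where
  obj := incObj
  map {X Y} f := TTS.homMk (X := incObj X) (Y := incObj Y)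
    (fun _ p => ⟨p.1, p.2 ≫ f⟩)
    (fun _ a => ⟨⟨a.1.1, a.1.2 ≫ f⟩, TTS.appTm f a.2.1,
      (TTS.appTy_bdTm f a.2.1).trans (congrArg (TTS.appTy f) a.2.2)⟩)
    (fun _ _ => rfl) (fun _ _ => rfl)
  map_id _ := TTS.hom_ext (fun _ _ => rfl) (fun _ _ => rfl)
  map_comp _ _ := TTS.hom_ext (fun _ _ => rfl) (fun _ _ => rfl)

end SubstGAT

/-! In a theory without equality axioms every derivable equality is a syntactic identity
(`Free.wf`), so the congruence on judgements is nothing but renaming of the declared variables.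

Without weakening and projection, substitution only fills an argument place of a constant. If a
type-element `A` has successive boundaries `A₁, …, Aₘ`, an instance of it is `A(s₀, …, sₘ₋₁)`, where
each `sᵢ` is either a variable not used before or is `a(s₀, …, sᵢ₋₁)` for a term-element `a` whose
boundary is that of the place `i`. Such argument lists are called spines here. The arguments that
are variables make up the context, in order. Instances of this form contain the basic judgements and
are closed under renaming and substitution (`Free.normal_of_derivable`). Conversely, replacing the
last constant-headed argument by a fresh variable and substituting it back derives every spine by
induction (`Free.IsSpine.derivable_of_eq_var`).

Up to renaming, a spine is thus a choice of `A`, of the places that remain variables, and of a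
term-element for every other place. The degrees of the variable places, together with `0` and the
degree of `A`, are the values of an inc-list `α`; `A` and the term-elements are the values of a map
`[α] ⟶ X`. A term judgement has in addition a term-element over `A`. Conversely `Free.canon` turns
`(α, h)` into a spine. Every spine agrees with such a one up to renaming
(`Free.IsSpine.exists_canon`), and the pair is recovered from the expression even after all
variables are identified (`Free.eq_of_erase_eq`), hence from the congruence class. -/

namespace SubstGAT

/-! ### Substitution and erasure of variable names -/

namespace Expr

variable {W : Type u}

theorem bind_congr {s s' : ℕ → Expr W} {e : Expr W} (h : ∀ x ∈ e.fv, s x = s' x) :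
    e.bind s = e.bind s' := by
  induction e with
  | var x => exact h x rfl
  | app w n e ih =>
    simp only [bind, app.injEq, heq_eq_eq, true_and]
    funext i
    exact ih i fun x hx => h x ⟨i, hx⟩

theorem bind_bind (s s' : ℕ → Expr W) (e : Expr W) :
    (e.bind s).bind s' = e.bind fun x => (s x).bind s' := by
  induction e with
  | var x => rfl
  | app w n e ih => simp only [bind, ih]

theorem bind_var (e : Expr W) : e.bind var = e := by
  induction e with
  | var x => rfl
  | app w n e ih => simp only [bind, ih]

theorem subst_of_notMem {e t : Expr W} {y : ℕ} (h : y ∉ e.fv) : e.subst t y = e := by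
  unfold subst
  rw [bind_congr (s' := var), bind_var]
  intro x hx
  exact Function.update_of_ne (by rintro rfl; exact h hx) _ _

theorem subst_var_self (t : Expr W) (y : ℕ) : (var y : Expr W).subst t y = t := by
  simp [subst, bind]

theorem subst_var_of_ne (t : Expr W) {x y : ℕ} (h : x ≠ y) :
    (var x : Expr W).subst t y = var x := by
  simp [subst, bind, Function.update_of_ne h]

/-- Replacing all variables by the same one. -/
def erase (e : Expr W) : Expr W := e.bind fun _ => var 0

/-- Erasure does not see renamings, even non-injective ones, so it yields an invariant of congruence
classes. -/
theorem erase_bind {s : ℕ → Expr W} (h : ∀ x, ∃ y, s x = var y) (e : Expr W) :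
    (e.bind s).erase = e.erase := by
  unfold erase
  rw [bind_bind]
  congr 1
  funext x
  obtain ⟨y, hy⟩ := h x
  rw [hy]
  rfl

end Expr

/-! ### Spines and the normal form of derivable judgements -/

namespace Free

variable {X : TTS.{u}}

/-- The context declared by the variables among `s 0, …, s (m - 1)`, when these are substituted for
the arguments of `A`. -/
def spineCtx : ∀ (m : ℕ), X.Ty m → (ℕ → Expr (Sym X)) → Ctx (Sym X)
  | 0, _, _ => []
  | m + 1, A, s =>
    match s m with
    | .var x => (x, (tyExpr (X.bdTy A)).bind s) :: spineCtx m (X.bdTy A) s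
    | .app _ _ _ => spineCtx m (X.bdTy A) s

/-- Each of `s 0, …, s (m - 1)` is either a fresh variable, or a term-constant over the successive
boundary of `A`, applied to its predecessors. -/
def IsSpine : ∀ (m : ℕ), X.Ty m → (ℕ → Expr (Sym X)) → Prop
  | 0, _, _ => True
  | m + 1, A, s => IsSpine m (X.bdTy A) s ∧
      ((∃ x, s m = .var x ∧ x ∉ (spineCtx m (X.bdTy A) s).vars) ∨
        ∃ a : X.Tm m, X.bdTm a = X.bdTy A ∧ s m = (tmExpr a).bind s)

theorem spineCtx_succ_var {m : ℕ} {A : X.Ty (m + 1)} {s : ℕ → Expr (Sym X)} {x : ℕ}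
    (h : s m = .var x) :
    spineCtx (m + 1) A s = (x, (tyExpr (X.bdTy A)).bind s) :: spineCtx m (X.bdTy A) s := by
  rw [spineCtx, h]

theorem spineCtx_succ_app {m : ℕ} {A : X.Ty (m + 1)} {s : ℕ → Expr (Sym X)} {w : Sym X} {n : ℕ}
    {e : Fin n → Expr (Sym X)} (h : s m = .app w n e) :
    spineCtx (m + 1) A s = spineCtx m (X.bdTy A) s := by
  rw [spineCtx, h]

theorem spineCtx_succ_tmExpr {m k : ℕ} {A : X.Ty (m + 1)} {s τ : ℕ → Expr (Sym X)} {a : X.Tm k}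
    (h : s m = (tmExpr a).bind τ) :
    spineCtx (m + 1) A s = spineCtx m (X.bdTy A) s :=
  spineCtx_succ_app h

theorem tyExpr_bind_congr {m : ℕ} (A : X.Ty m) {s s' : ℕ → Expr (Sym X)}
    (h : ∀ i < m, s i = s' i) : (tyExpr A).bind s = (tyExpr A).bind s' := by
  apply Expr.bind_congr
  rintro x ⟨i, rfl⟩
  exact h _ i.2

theorem tmExpr_bind_congr {m : ℕ} (a : X.Tm m) {s s' : ℕ → Expr (Sym X)}
    (h : ∀ i < m, s i = s' i) : (tmExpr a).bind s = (tmExpr a).bind s' := by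
  apply Expr.bind_congr
  rintro x ⟨i, rfl⟩
  exact h _ i.2

/-- The symbol carries its degree, so an instance remembers both the constant and its arguments.
Only the values below `m` occur in it; this is why spines are compared only there. -/
theorem tyExpr_bind_inj {m n : ℕ} {A : X.Ty m} {B : X.Ty n} {s s' : ℕ → Expr (Sym X)}
    (h : (tyExpr A).bind s = (tyExpr B).bind s') :
    (⟨m, A⟩ : Σ k, X.Ty k) = ⟨n, B⟩ ∧ ∀ i < m, s i = s' i := by
  simp only [tyExpr, Expr.bind, Expr.app.injEq, Sum.inl.injEq] at h
  obtain ⟨h, -, h'⟩ := h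
  cases h
  exact ⟨rfl, fun i hi => congrFun (eq_of_heq h') ⟨i, hi⟩⟩

theorem tmExpr_bind_inj {m n : ℕ} {a : X.Tm m} {b : X.Tm n} {s s' : ℕ → Expr (Sym X)}
    (h : (tmExpr a).bind s = (tmExpr b).bind s') :
    (⟨m, a⟩ : Σ k, X.Tm k) = ⟨n, b⟩ ∧ ∀ i < m, s i = s' i := by
  simp only [tmExpr, Expr.bind, Expr.app.injEq, Sum.inr.injEq] at h
  obtain ⟨h, -, h'⟩ := h
  cases h
  exact ⟨rfl, fun i hi => congrFun (eq_of_heq h') ⟨i, hi⟩⟩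

theorem spineCtx_congr {m : ℕ} (A : X.Ty m) {s s' : ℕ → Expr (Sym X)}
    (h : ∀ i < m, s i = s' i) : spineCtx m A s = spineCtx m A s' := by
  induction m with
  | zero => rfl
  | succ m ih =>
    have h' : ∀ i < m, s i = s' i := fun i hi => h i (hi.trans m.lt_succ_self)
    have hm := h m m.lt_succ_self
    cases e : s m with
    | var x =>
      rw [spineCtx_succ_var e, spineCtx_succ_var (hm.symm.trans e), ih _ h',
        tyExpr_bind_congr _ h']
    | app w n t => rw [spineCtx_succ_app e, spineCtx_succ_app (hm.symm.trans e), ih _ h']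

theorem IsSpine.congr {m : ℕ} {A : X.Ty m} {s s' : ℕ → Expr (Sym X)} (hs : IsSpine m A s)
    (h : ∀ i < m, s i = s' i) : IsSpine m A s' := by
  induction m with
  | zero => trivial
  | succ m ih =>
    have h' : ∀ i < m, s i = s' i := fun i hi => h i (hi.trans m.lt_succ_self)
    refine ⟨ih hs.1 h', ?_⟩
    rw [← h m m.lt_succ_self, ← spineCtx_congr _ h']
    simpa only [tmExpr_bind_congr _ h'] using hs.2

theorem mem_vars_spineCtx {m : ℕ} {A : X.Ty m} {s : ℕ → Expr (Sym X)} {x : ℕ} :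
    x ∈ (spineCtx m A s).vars ↔ ∃ i < m, s i = .var x := by
  induction m with
  | zero => simp [spineCtx, Ctx.vars]
  | succ m ih =>
    simp only [Nat.lt_succ_iff_lt_or_eq, or_and_right, exists_or, exists_eq_left,
      ← ih (A := X.bdTy A)]
    cases e : s m with
    | var y =>
      rw [spineCtx_succ_var e]
      simp [Ctx.vars, or_comm, eq_comm]
    | app w n t =>
      rw [spineCtx_succ_app e]
      simp

theorem IsSpine.eq_or {m : ℕ} {A : X.Ty (m + 1)} {s : ℕ → Expr (Sym X)}
    (hs : IsSpine (m + 1) A s) :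
    (∃ x, s m = .var x) ∨ ∃ a : X.Tm m, X.bdTm a = X.bdTy A ∧ s m = (tmExpr a).bind s :=
  hs.2.imp_left fun ⟨x, hx, _⟩ => ⟨x, hx⟩

/-- A constant-headed argument contains only variables of earlier arguments. Hence a variable that
is not declared by the spine may be substituted without effect. -/
theorem IsSpine.fv_subset {m : ℕ} {A : X.Ty m} {s : ℕ → Expr (Sym X)} (hs : IsSpine m A s)
    {i : ℕ} (hi : i < m) {y : ℕ} (hy : y ∈ (s i).fv) : y ∈ (spineCtx m A s).vars := by
  rw [mem_vars_spineCtx]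
  induction m generalizing i with
  | zero => cases hi
  | succ m ih =>
    obtain hi | rfl := Nat.lt_succ_iff_lt_or_eq.1 hi
    · obtain ⟨j, hj, h⟩ := ih hs.1 hi hy
      exact ⟨j, hj.trans m.lt_succ_self, h⟩
    · obtain ⟨x, hx⟩ | ⟨a, -, ha⟩ := hs.eq_or
      · rw [hx] at hy
        obtain rfl : y = x := hy
        exact ⟨i, hi, hx⟩
      · rw [ha] at hy
        obtain ⟨j, hj⟩ := hy
        obtain ⟨l, hl, h⟩ := ih hs.1 j.2 hj
        exact ⟨l, hl.trans i.lt_succ_self, h⟩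

theorem isSpine_var {m : ℕ} (A : X.Ty m) : IsSpine m A .var ∧ spineCtx m A .var = ctx m A := by
  induction m with
  | zero => exact ⟨trivial, rfl⟩
  | succ m ih =>
    refine ⟨⟨(ih _).1, Or.inl ⟨m, rfl, ?_⟩⟩, ?_⟩
    · rw [mem_vars_spineCtx]
      rintro ⟨i, hi, h⟩
      cases h
      exact lt_irrefl _ hi
    · rw [spineCtx_succ_var rfl, (ih _).2, Expr.bind_var]
      rfl

theorem spineCtx_perm (σ : Equiv.Perm ℕ) {m : ℕ} (A : X.Ty m) (s : ℕ → Expr (Sym X)) :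
    spineCtx m A (fun i => (s i).perm σ) = (spineCtx m A s).perm σ := by
  induction m with
  | zero => rfl
  | succ m ih =>
    cases e : s m with
    | var x =>
      rw [spineCtx_succ_var e, spineCtx_succ_var (x := σ x) (by rw [e]; rfl), ih]
      simp only [Ctx.perm, List.map_cons, Expr.perm, Expr.bind_bind]
    | app w n t =>
      rw [spineCtx_succ_app e, spineCtx_succ_app (by rw [e]; rfl), ih]

theorem IsSpine.perm (σ : Equiv.Perm ℕ) {m : ℕ} {A : X.Ty m} {s : ℕ → Expr (Sym X)}
    (hs : IsSpine m A s) : IsSpine m A (fun i => (s i).perm σ) := by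
  induction m with
  | zero => trivial
  | succ m ih =>
    refine ⟨ih hs.1, ?_⟩
    obtain ⟨-, ⟨x, hx, hx'⟩ | ⟨a, ha, ha'⟩⟩ := hs
    · refine Or.inl ⟨σ x, by simp only [hx]; rfl, ?_⟩
      rw [spineCtx_perm]
      simpa [Ctx.vars, Ctx.perm] using hx'
    · refine Or.inr ⟨a, ha, ?_⟩
      simp only [ha', Expr.perm, Expr.bind_bind]

/-- The declaration of `y` sits at some variable place of the spine. As expressions determine their
constants and arguments, its type shows that `∂a` is the successive boundary of `A` at this place
and that `s'` agrees with `s` before it. Putting `a(s')` there is therefore exactly the second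
alternative in the definition of a spine. -/
theorem IsSpine.subst {m n : ℕ} {A : X.Ty m} {a : X.Tm n} {s s' : ℕ → Expr (Sym X)}
    {Δ : Ctx (Sym X)} {y : ℕ} (hs : IsSpine m A s)
    (h : spineCtx m A s =
      Δ ++ (y, (tyExpr (X.bdTm a)).bind s') :: spineCtx n (X.bdTm a) s') :
    IsSpine m A (fun i => (s i).subst ((tmExpr a).bind s') y) ∧
      spineCtx m A (fun i => (s i).subst ((tmExpr a).bind s') y) =
        Δ.subst ((tmExpr a).bind s') y ++ spineCtx n (X.bdTm a) s' := by
  induction m generalizing Δ with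
  | zero => simp [spineCtx] at h
  | succ m ih =>
    obtain ⟨hs', ⟨x, hx, hx'⟩ | ⟨b, hb, hb'⟩⟩ := hs
    · rw [spineCtx_succ_var hx] at h
      -- If `Δ` is empty, the substituted place is the last argument; otherwise it lies further to
      -- the left.
      cases Δ with
      | nil =>
        simp only [List.nil_append, List.cons.injEq, Prod.mk.injEq] at h
        obtain ⟨⟨rfl, hT⟩, hΓ⟩ := h
        obtain ⟨hA, hss⟩ := tyExpr_bind_inj hT
        have hn : m = n := congrArg Sigma.fst hA
        subst hn
        obtain hA : X.bdTy A = X.bdTm a := eq_of_heq (Sigma.mk.inj hA).2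
        have key : ∀ i < m, s i = (s i).subst ((tmExpr a).bind s') x := fun i hi =>
          (Expr.subst_of_notMem fun hy => hx' (hs'.fv_subset hi hy)).symm
        have hm : (fun i => (s i).subst ((tmExpr a).bind s') x) m = (tmExpr a).bind s' := by
          simp only [hx, Expr.subst_var_self]
        refine ⟨⟨hs'.congr key, Or.inr ⟨a, hA.symm, ?_⟩⟩, ?_⟩
        · rw [hm]
          exact tmExpr_bind_congr _ fun i hi => (hss i hi).symm.trans (key i hi)
        · rw [spineCtx_succ_tmExpr
            (s := fun i => (s i).subst ((tmExpr a).bind s') x) hm,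
            ← spineCtx_congr _ key, hΓ]
          rfl
      | cons p Δ =>
        simp only [List.cons_append, List.cons.injEq] at h
        obtain ⟨rfl, h⟩ := h
        obtain ⟨ih₁, ih₂⟩ := ih hs' h
        have hxy : x ≠ y := by
          rintro rfl
          apply hx'
          rw [h]
          simp [Ctx.vars]
        have hm : (fun i => (s i).subst ((tmExpr a).bind s') y) m = .var x := by
          simp only [hx, Expr.subst_var_of_ne _ hxy]
        refine ⟨⟨ih₁, Or.inl ⟨x, hm, ?_⟩⟩, ?_⟩
        · rw [ih₂]
          rw [h] at hx'
          simp only [Ctx.vars, List.map_append, List.mem_append, List.map_cons, List.mem_cons,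
            not_or] at hx'
          simp only [Ctx.vars, Ctx.subst, List.map_append, List.mem_append, List.map_map, not_or]
          exact ⟨hx'.1, hx'.2.2⟩
        · rw [spineCtx_succ_var
            (s := fun i => (s i).subst ((tmExpr a).bind s') y) hm, ih₂]
          simp only [Ctx.subst, List.map_cons, List.cons_append, Expr.subst, Expr.bind_bind]
    -- A constant-headed last argument declares nothing, so the same splitting of the context holds
    -- for the shorter spine.
    · rw [spineCtx_succ_tmExpr hb'] at h
      obtain ⟨ih₁, ih₂⟩ := ih hs' h
      have hm : (fun i => (s i).subst ((tmExpr a).bind s') y) m =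
          (tmExpr b).bind fun i => (s i).subst ((tmExpr a).bind s') y := by
        simp only [hb', Expr.subst, Expr.bind_bind]
      exact ⟨⟨ih₁, Or.inr ⟨b, hb, hm⟩⟩, by rw [spineCtx_succ_tmExpr
        (s := fun i => (s i).subst ((tmExpr a).bind s') y) hm, ih₂]⟩

/-- The normal form of the type and term judgements of the free `{s}`-GAT. -/
def Normal (Γ : Ctx (Sym X)) : Body (Sym X) → Prop
  | .ty T => ∃ (m : ℕ) (A : X.Ty m) (s : ℕ → Expr (Sym X)),
      IsSpine m A s ∧ Γ = spineCtx m A s ∧ T = (tyExpr A).bind s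
  | .tm t T => ∃ (m : ℕ) (a : X.Tm m) (s : ℕ → Expr (Sym X)),
      IsSpine m (X.bdTm a) s ∧ Γ = spineCtx m (X.bdTm a) s ∧ T = (tyExpr (X.bdTm a)).bind s ∧
        t = (tmExpr a).bind s
  | _ => True

/-- Equality judgements need no normal form: by `wf` their two sides coincide, so conversion along a
type equality changes nothing. -/
theorem normal_of_derivable {J : Judgement (Sym X)} (hJ : Derivable {Rule.s} (basic X) J) :
    Normal J.ctx J.body := by
  induction hJ with
  | basic J hJ h ih =>
    rcases hJ with ⟨k, A, rfl⟩ | ⟨k, a, rfl⟩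
    · exact ⟨k, A, .var, (isSpine_var A).1, (isSpine_var A).2.symm, (Expr.bind_var _).symm⟩
    · exact ⟨k, a, .var, (isSpine_var _).1, (isSpine_var _).2.symm, (Expr.bind_var _).symm,
        (Expr.bind_var _).symm⟩
  | tm_conv Γ T₁ T₂ t h h' ih ih' =>
    obtain ⟨-, rfl, -⟩ := wf h
    exact ih'
  | alpha σ Γ 𝒥 h ih =>
    cases 𝒥 with
    | ty T =>
      obtain ⟨m, A, s, hs, rfl, rfl⟩ := ih
      exact ⟨m, A, _, hs.perm σ, (spineCtx_perm σ A s).symm, Expr.bind_bind _ _ _⟩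
    | tm t T =>
      obtain ⟨m, a, s, hs, rfl, rfl, rfl⟩ := ih
      exact ⟨m, a, _, hs.perm σ, (spineCtx_perm σ _ s).symm, Expr.bind_bind _ _ _, Expr.bind_bind _ _ _⟩
    | tyEq T T' => trivial
    | tmEq t t' T => trivial
  | weakening Γ Δ y T 𝒥 hw => cases hw
  | projection Γ y T hp => cases hp
  | substitution Γ Δ y t T 𝒥 hs ht h iht ih =>
    obtain ⟨n, a, s', -, rfl, rfl, rfl⟩ := iht
    cases 𝒥 with
    | ty T' =>
      obtain ⟨m, A, s, hs, hΓ, rfl⟩ := ih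
      exact ⟨m, A, _, (hs.subst hΓ.symm).1, (hs.subst hΓ.symm).2.symm, Expr.bind_bind _ _ _⟩
    | tm t' T' =>
      obtain ⟨m, b, s, hs, hΓ, rfl, rfl⟩ := ih
      exact ⟨m, b, _, (hs.subst hΓ.symm).1, (hs.subst hΓ.symm).2.symm, Expr.bind_bind _ _ _,
        Expr.bind_bind _ _ _⟩
    | tyEq T' T'' => trivial
    | tmEq t' t'' T' => trivial
  | _ => trivial

/-! ### Derivability of all spines -/

theorem IsSpine.exists_perm {m : ℕ} {A : X.Ty m} {s : ℕ → Expr (Sym X)} (hs : IsSpine m A s)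
    (h : ∀ i < m, ∃ x, s i = .var x) :
    ∃ σ : Equiv.Perm ℕ, ∀ i < m, s i = (Expr.var i).perm σ := by
  induction m with
  | zero => exact ⟨1, fun i hi => absurd hi i.not_lt_zero⟩
  | succ m ih =>
    obtain ⟨σ, hσ⟩ := ih hs.1 fun i hi => h i (hi.trans m.lt_succ_self)
    obtain ⟨-, ⟨x, hx, hx'⟩ | ⟨a, -, ha⟩⟩ := hs
    -- The transposition sends `σ m` to `x` and fixes the earlier values: they differ from `σ m` by
    -- injectivity and from `x` by freshness.
    · refine ⟨σ.trans (Equiv.swap (σ m) x), fun i hi => ?_⟩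
      obtain hi | rfl := Nat.lt_succ_iff_lt_or_eq.1 hi
      · have hix : σ i ≠ x := by
          rintro rfl
          exact hx' (mem_vars_spineCtx.2 ⟨i, hi, hσ i hi⟩)
        rw [hσ i hi]
        simp only [Expr.perm, Expr.bind, Equiv.trans_apply]
        rw [Equiv.swap_apply_of_ne_of_ne (σ.injective.ne hi.ne) hix]
      · rw [hx]
        simp [Expr.perm, Expr.bind]
    · obtain ⟨x, hx⟩ := h m m.lt_succ_self
      rw [ha] at hx
      cases hx

/-- This reverses a substitution. A later constant-headed argument would repeat the expression at
place `m`; as all later arguments are variables, that place can be changed alone without destroying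
the spine. -/
theorem IsSpine.exists_update {m n : ℕ} (hmn : m < n) {A : X.Ty n} {s : ℕ → Expr (Sym X)}
    (hs : IsSpine n A s) (hv : ∀ i, m < i → i < n → ∃ x, s i = .var x) {y : ℕ}
    (hy : y ∉ (spineCtx n A s).vars) :
    (∃ x, s m = .var x) ∨ ∃ (a : X.Tm m) (Δ : Ctx (Sym X)), IsSpine m (X.bdTm a) s ∧
      s m = (tmExpr a).bind s ∧ IsSpine n A (Function.update s m (.var y)) ∧
      spineCtx n A (Function.update s m (.var y)) =
        Δ ++ (y, (tyExpr (X.bdTm a)).bind s) :: spineCtx m (X.bdTm a) s := by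
  induction n with
  | zero => cases hmn
  | succ n ih =>
    obtain hmn | rfl := Nat.lt_succ_iff_lt_or_eq.1 hmn
    · obtain ⟨x, hx⟩ := hv n hmn n.lt_succ_self
      have hxn : x ∉ (spineCtx n (X.bdTy A) s).vars := by
        obtain ⟨-, ⟨x', h, h'⟩ | ⟨a, -, ha⟩⟩ := hs
        · cases hx.symm.trans h
          exact h'
        · cases ha.symm.trans hx
      rw [spineCtx_succ_var hx] at hy
      obtain ⟨hyx, hy⟩ := not_or.1 (mt List.mem_cons.2 hy)
      refine (ih hmn hs.1 (fun i hi hi' => hv i hi (hi'.trans n.lt_succ_self)) hy).imp_right ?_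
      rintro ⟨a, Δ, ha, hm, hu, hc⟩
      have hx' : Function.update s m (.var y) n = .var x := by
        rw [Function.update_of_ne hmn.ne', hx]
      refine ⟨a, (x, (tyExpr (X.bdTy A)).bind (Function.update s m (.var y))) :: Δ, ha, hm,
        ⟨hu, Or.inl ⟨x, hx', fun h => ?_⟩⟩, ?_⟩
      · obtain ⟨i, hi, h⟩ := mem_vars_spineCtx.1 h
        by_cases him : i = m
        · subst him
          rw [Function.update_self] at h
          cases h
          exact hyx rfl
        · rw [Function.update_of_ne him] at h
          exact hxn (mem_vars_spineCtx.2 ⟨i, hi, h⟩)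
      · rw [spineCtx_succ_var hx', hc]
        rfl
    · obtain ⟨hs', ⟨x, hx, -⟩ | ⟨a, ha, ha'⟩⟩ := hs
      · exact Or.inl ⟨x, hx⟩
      · refine Or.inr ⟨a, [], ha ▸ hs', ha', ?_⟩
        have key : ∀ i < m, s i = Function.update s m (.var y) i := fun i hi =>
          (Function.update_of_ne hi.ne _ _).symm
        have hm : Function.update s m (.var y) m = .var y := Function.update_self _ _ _
        rw [spineCtx_succ_tmExpr ha'] at hy
        refine ⟨⟨hs'.congr key, Or.inl ⟨y, hm, by rwa [← spineCtx_congr _ key]⟩⟩, ?_⟩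
        rw [spineCtx_succ_var hm, ← spineCtx_congr _ key, ← tyExpr_bind_congr _ key, ha]
        rfl

/-- Induction on a bound for the constant-headed places. With none of them, the judgement is a
renamed basic one. Otherwise it arises by substituting the term at place `m` for a fresh variable.
The length `n` varies because that term is itself an instance of length `m`. -/
theorem IsSpine.derivable_of_eq_var (m : ℕ) : ∀ {n : ℕ} {A : X.Ty n} {s : ℕ → Expr (Sym X)},
    IsSpine n A s → (∀ i, m ≤ i → i < n → ∃ x, s i = .var x) →
    Derivable {Rule.s} (basic X) ⟨spineCtx n A s, .ty ((tyExpr A).bind s)⟩ ∧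
      ∀ a : X.Tm n, X.bdTm a = A → Derivable {Rule.s} (basic X)
        ⟨spineCtx n A s, .tm ((tmExpr a).bind s) ((tyExpr A).bind s)⟩ := by
  induction m with
  | zero =>
    intro n A s hs h
    obtain ⟨σ, hσ⟩ := hs.exists_perm fun i hi => h i i.zero_le hi
    rw [spineCtx_congr _ hσ, tyExpr_bind_congr _ hσ, spineCtx_perm σ A .var, (isSpine_var A).2]
    refine ⟨.alpha σ _ _ (derivable_ty _ A), ?_⟩
    rintro a rfl
    rw [tmExpr_bind_congr _ hσ]
    exact .alpha σ _ _ (derivable_tm _ a)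
  | succ m ih =>
    intro n A s hs h
    by_cases hmn : m < n
    swap
    · exact ih hs fun i hi hi' => absurd (hi.trans_lt hi') hmn
    obtain ⟨y, hy⟩ := Infinite.exists_notMem_finset (spineCtx n A s).vars.toFinset
    rw [List.mem_toFinset] at hy
    obtain ⟨x, hx⟩ | ⟨a, Δ, ha, hm, hu, hc⟩ := hs.exists_update hmn h hy
    · refine ih hs fun i hi hi' => ?_
      obtain rfl | hi := hi.eq_or_lt
      · exact ⟨x, hx⟩
      · exact h i hi hi'
    -- For a spine of length `m` the condition on the places from `m` on is vacuous.
    have ht := (ih ha fun i hi hi' => absurd (hi.trans_lt hi') (lt_irrefl m)).2 a rfl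
    have key : ∀ i < n,
        (Function.update s m (.var y) i).subst ((tmExpr a).bind s) y = s i := by
      intro i hi
      by_cases him : i = m
      · subst him
        rw [Function.update_self, Expr.subst_var_self, hm]
      · rw [Function.update_of_ne him, Expr.subst_of_notMem fun h => hy (hs.fv_subset hi h)]
    have hΓ := (hu.subst hc).2
    rw [spineCtx_congr _ key] at hΓ
    obtain ⟨hty, htm⟩ := ih hu fun i hi hi' => by
      obtain rfl | hi := hi.eq_or_lt
      · exact ⟨y, Function.update_self _ _ _⟩
      · rw [Function.update_of_ne hi.ne']
        exact h i hi hi'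
    have hT : ((tyExpr A).bind (Function.update s m (.var y))).subst ((tmExpr a).bind s) y =
        (tyExpr A).bind s := (Expr.bind_bind _ _ _).trans (tyExpr_bind_congr _ key)
    rw [hc] at hty htm
    rw [hΓ, ← hT]
    refine ⟨.substitution _ _ _ _ _ _ (Set.mem_singleton _) ht hty, fun b hb => ?_⟩
    rw [show (tmExpr b).bind s = _ from
      ((Expr.bind_bind _ _ _).trans (tmExpr_bind_congr b key)).symm]
    exact .substitution _ _ _ _ _ _ (Set.mem_singleton _) ht (htm b hb)

theorem IsSpine.derivable_ty {m : ℕ} {A : X.Ty m} {s : ℕ → Expr (Sym X)} (hs : IsSpine m A s) :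
    Derivable {Rule.s} (basic X) ⟨spineCtx m A s, .ty ((tyExpr A).bind s)⟩ :=
  (hs.derivable_of_eq_var m fun _ hi hi' => absurd hi hi'.not_ge).1

theorem IsSpine.derivable_tm {m : ℕ} {A : X.Ty m} {s : ℕ → Expr (Sym X)} (hs : IsSpine m A s)
    {a : X.Tm m} (ha : X.bdTm a = A) :
    Derivable {Rule.s} (basic X)
      ⟨spineCtx m A s, .tm ((tmExpr a).bind s) ((tyExpr A).bind s)⟩ :=
  (hs.derivable_of_eq_var m fun _ hi hi' => absurd hi hi'.not_ge).2 a ha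

end Free

/-! ### Congruence of spines -/

theorem Ctx.ren_eq_var {W : Type u} : ∀ (Γ Γ' : Ctx W) (z : ℕ), ∃ y, Ctx.ren Γ Γ' z = .var y
  | (x, _) :: Γ, (y, _) :: Γ', z => by
    rw [Ctx.ren]
    by_cases h : z = y
    · subst h
      exact ⟨x, Function.update_self _ _ _⟩
    · rw [Function.update_of_ne h]
      exact Ctx.ren_eq_var Γ Γ' z
  | [], [], z => ⟨z, rfl⟩
  | [], _ :: _, z => ⟨z, rfl⟩
  | _ :: _, [], z => ⟨z, rfl⟩

namespace Free

variable {X : TTS.{u}}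

theorem eq_of_derivable_tyEq {Γ : Ctx (Sym X)} {S T : Expr (Sym X)}
    (h : (freeGAT {Rule.s} X).Derives ⟨Γ, .tyEq S T⟩) : S = T :=
  (wf h).2.1

theorem erase_eq_of_tyCongr {Γ Γ' : Ctx (Sym X)} {S T : Expr (Sym X)}
    (h : (freeGAT {Rule.s} X).TyCongr Γ S Γ' T) : S.erase = T.erase := by
  match Γ, Γ', h with
  | [], [], h => rw [eq_of_derivable_tyEq h]
  | _ :: _, _ :: _, h =>
    rw [eq_of_derivable_tyEq h.2, Expr.erase_bind (Ctx.ren_eq_var _ _)]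

theorem erase_eq_of_tmCongr {Γ Γ' : Ctx (Sym X)} {s S t T : Expr (Sym X)}
    (h : (freeGAT {Rule.s} X).TmCongr Γ s S Γ' t T) : s.erase = t.erase := by
  rw [show s = _ from (wf h.2).2.1, Expr.erase_bind (Ctx.ren_eq_var _ _)]

/-- The final types enter only the last clause of the congruence, so they may be exchanged over the
same contexts. This serves a constant-headed last argument, which leaves the context unchanged. -/
theorem tyCongr_of_tyCongr {Γ Γ' : Ctx (Sym X)} {S S' T T' : Expr (Sym X)}
    (h : (freeGAT {Rule.s} X).TyCongr Γ S Γ' T)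
    (h' : (freeGAT {Rule.s} X).Derives ⟨Γ, .tyEq S' (T'.bind (Ctx.ren Γ Γ'))⟩) :
    (freeGAT {Rule.s} X).TyCongr Γ S' Γ' T' := by
  match Γ, Γ', h with
  | [], [], h =>
    rw [show Ctx.ren [] [] = Expr.var from rfl, Expr.bind_var] at h'
    exact h'
  | _ :: _, _ :: _, h => exact ⟨h.1, h'⟩

/-- The same arguments of two spines are variables, and the others have the same heads. -/
def SamePattern (X : TTS.{u}) (m : ℕ) (s s' : ℕ → Expr (Sym X)) : Prop :=
  ∀ i < m, (∃ x x', s i = .var x ∧ s' i = .var x') ∨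
    ∃ a : X.Tm i, s i = (tmExpr a).bind s ∧ s' i = (tmExpr a).bind s'

theorem IsSpine.bind_ren {m : ℕ} {A : X.Ty m} {s s' : ℕ → Expr (Sym X)}
    (hs' : IsSpine m A s') (h : SamePattern X m s s') :
    ∀ i < m, (s' i).bind (Ctx.ren (spineCtx m A s) (spineCtx m A s')) = s i := by
  induction m with
  | zero => exact fun i hi => absurd hi i.not_lt_zero
  | succ m ih =>
    have ih := ih hs'.1 fun i hi => h i (hi.trans m.lt_succ_self)
    intro i hi
    obtain ⟨x, x', hx, hx'⟩ | ⟨a, ha, ha'⟩ := h m m.lt_succ_self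
    · rw [spineCtx_succ_var hx, spineCtx_succ_var hx', Ctx.ren]
      obtain hi | rfl := Nat.lt_succ_iff_lt_or_eq.1 hi
      -- The new entry of the renaming concerns `x'`, which is fresh for the earlier arguments of
      -- `s'`.
      · rw [← ih i hi]
        apply Expr.bind_congr
        intro z hz
        rw [Function.update_of_ne]
        rintro rfl
        obtain ⟨hs, ⟨y, hy, hy'⟩ | ⟨a, -, ha⟩⟩ := hs'
        · cases hx'.symm.trans hy
          exact hy' (hs.fv_subset hi hz)
        · cases hx'.symm.trans ha
      · rw [hx, hx', Expr.bind, Function.update_self]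
    · rw [spineCtx_succ_tmExpr ha, spineCtx_succ_tmExpr ha']
      obtain hi | rfl := Nat.lt_succ_iff_lt_or_eq.1 hi
      · exact ih i hi
      · rw [ha, ha', Expr.bind_bind]
        exact tmExpr_bind_congr _ ih

theorem IsSpine.tyCongr {m : ℕ} {A : X.Ty m} {s s' : ℕ → Expr (Sym X)} (hs : IsSpine m A s)
    (hs' : IsSpine m A s') (h : SamePattern X m s s') :
    (freeGAT {Rule.s} X).TyCongr (spineCtx m A s) ((tyExpr A).bind s) (spineCtx m A s')
      ((tyExpr A).bind s') := by
  have key : (freeGAT {Rule.s} X).Derives ⟨spineCtx m A s, .tyEq ((tyExpr A).bind s)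
      (((tyExpr A).bind s').bind (Ctx.ren (spineCtx m A s) (spineCtx m A s')))⟩ := by
    rw [Expr.bind_bind, tyExpr_bind_congr A (hs'.bind_ren h)]
    exact .ty_refl _ _ hs.derivable_ty
  induction m with
  | zero =>
    rw [show Ctx.ren (spineCtx 0 A s) (spineCtx 0 A s') = Expr.var from rfl, Expr.bind_var] at key
    exact key
  | succ m ih =>
    have h' : SamePattern X m s s' := fun i hi => h i (hi.trans m.lt_succ_self)
    have ih := ih hs.1 hs'.1 h' (by
      rw [Expr.bind_bind, tyExpr_bind_congr _ (hs'.1.bind_ren h')]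
      exact .ty_refl _ _ hs.1.derivable_ty)
    obtain ⟨x, x', hx, hx'⟩ | ⟨a, ha, ha'⟩ := h m m.lt_succ_self
    · rw [spineCtx_succ_var hx, spineCtx_succ_var hx'] at key ⊢
      exact ⟨ih, key⟩
    · rw [spineCtx_succ_tmExpr ha, spineCtx_succ_tmExpr ha'] at key ⊢
      exact tyCongr_of_tyCongr ih key

theorem IsSpine.tmCongr {m : ℕ} {A : X.Ty m} {s s' : ℕ → Expr (Sym X)} (hs : IsSpine m A s)
    (hs' : IsSpine m A s') (h : SamePattern X m s s') {a : X.Tm m} (ha : X.bdTm a = A) :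
    (freeGAT {Rule.s} X).TmCongr (spineCtx m A s) ((tmExpr a).bind s) ((tyExpr A).bind s)
      (spineCtx m A s') ((tmExpr a).bind s') ((tyExpr A).bind s') := by
  refine ⟨hs.tyCongr hs' h, ?_⟩
  rw [Expr.bind_bind, tmExpr_bind_congr a (hs'.bind_ren h)]
  exact .tm_refl _ _ _ (hs.derivable_tm ha)

end Free

/-! ### The judgement determined by an inc-list and a map -/

namespace Inc

theorem succ_le {n : ℕ} {α : Inc n} {i : ℕ} (E : (α.shape : TTS.{u}).Ty i) : i + 1 ≤ α.last :=
  (show ULift.{u} (PLift (i + 1 ≤ α.last)) from E).down.down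

theorem tm_prop {n : ℕ} {α : Inc n} {i : ℕ} (E : (α.shape : TTS.{u}).Tm i) :
    i + 1 ≤ α.last ∧ i + 1 ∉ Set.range α.val :=
  (show ULift.{u} (PLift (i + 1 ≤ α.last ∧ i + 1 ∉ Set.range α.val)) from E).down.down

/-- The type-element of `[α]` of a given degree. -/
def tyElt {n : ℕ} (α : Inc n) {i : ℕ} (H : i + 1 ≤ α.last) : (α.shape : TTS.{u}).Ty i :=
  ULift.up (PLift.up H)

/-- The term-element of `[α]` of a given degree. -/
def tmElt {n : ℕ} (α : Inc n) {i : ℕ} (H : i + 1 ≤ α.last ∧ i + 1 ∉ Set.range α.val) :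
    (α.shape : TTS.{u}).Tm i :=
  ULift.up (PLift.up H)

theorem last_mem_range {n : ℕ} (α : Inc n) : α.last ∈ Set.range α.val := ⟨_, rfl⟩

theorem bd_range_subset {n : ℕ} (α : Inc (n + 1)) : Set.range α.bd.val ⊆ Set.range α.val := by
  rintro _ ⟨i, rfl⟩
  exact ⟨i.castSucc, rfl⟩

theorem eq_last_of_mem_range {n : ℕ} (α : Inc (n + 1)) {x : ℕ} (hx : x ∈ Set.range α.val)
    (h : α.bd.last < x) : x = α.last := by
  obtain ⟨j, rfl⟩ := hx
  induction j using Fin.lastCases with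
  | last => rfl
  | cast j => exact absurd (α.bd.mono.monotone (Fin.le_last j)) (not_le.2 h)

theorem last_zero (α : Inc 0) : α.last = 0 := α.zero

end Inc

namespace Free

variable {X Y : TTS.{u}}

open Classical in
/-- The term-element assigned by `h` to the position `i`, or `none` if this is the position of a
variable. -/
noncomputable def label {n : ℕ} (α : Inc n) (h : α.shape ⟶ X) (i : ℕ) : Option (X.Tm i) :=
  if H : i + 1 ≤ α.last ∧ i + 1 ∉ Set.range α.val then some (TTS.appTm h (α.tmElt H)) else none

/-- The arguments of the judgement determined by an inc-list and a map; the variable in position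
`i` is `i`. -/
noncomputable def canon {n : ℕ} (α : Inc n) (h : α.shape ⟶ X) (i : ℕ) : Expr (Sym X) :=
  match label α h i with
  | none => .var i
  | some a => .app (.inr ⟨i, a⟩) i fun j => canon α h j
termination_by i
decreasing_by exact j.2

theorem canon_of_mem {n : ℕ} (α : Inc n) (h : α.shape ⟶ X) {i : ℕ}
    (H : i + 1 ∈ Set.range α.val) : canon α h i = .var i := by
  rw [canon, label, dif_neg fun H' => H'.2 H]

theorem canon_of_notMem {n : ℕ} (α : Inc n) (h : α.shape ⟶ X) {i : ℕ}
    (H : i + 1 ≤ α.last ∧ i + 1 ∉ Set.range α.val) :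
    canon α h i = (tmExpr (TTS.appTm h (α.tmElt H))).bind (canon α h) := by
  rw [canon, label, dif_pos H]
  rfl

/-- The term-elements of `[α]` sit exactly at the places that are not variables, and `h` preserves
their boundaries. Freshness is automatic because the variable at place `m` is `m` itself. -/
theorem canon_isSpine {n : ℕ} (α : Inc n) (h : α.shape ⟶ X) {m : ℕ} (E : α.shape.Ty m) :
    IsSpine m (TTS.appTy h E) (canon α h) := by
  induction m with
  | zero => trivial
  | succ m ih =>
    rw [IsSpine, TTS.appTy_bdTy]
    refine ⟨ih _, ?_⟩
    by_cases H : m + 1 ∈ Set.range α.val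
    · refine Or.inl ⟨m, canon_of_mem α h H, ?_⟩
      rw [mem_vars_spineCtx]
      rintro ⟨i, hi, h'⟩
      by_cases Hi : i + 1 ∈ Set.range α.val
      · rw [canon_of_mem α h Hi] at h'
        cases h'
        exact lt_irrefl _ hi
      · rw [canon_of_notMem α h ⟨(Nat.succ_le_succ hi.le).trans
          (m.succ.le_succ.trans (Inc.succ_le E)), Hi⟩] at h'
        cases h'
    · exact Or.inr ⟨_, TTS.appTy_bdTm h _,
        canon_of_notMem α h ⟨(Nat.le_succ _).trans (Inc.succ_le E), H⟩⟩

theorem spineCtx_canon_eq_nil {n : ℕ} (α : Inc n) (h : α.shape ⟶ X) {m : ℕ} (E : α.shape.Ty m)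
    (H : ∀ j < m, j + 1 ∉ Set.range α.val) : spineCtx m (TTS.appTy h E) (canon α h) = [] := by
  induction m with
  | zero => rfl
  | succ m ih =>
    rw [spineCtx_succ_tmExpr (canon_of_notMem α h
      ⟨(Nat.le_succ _).trans (Inc.succ_le E), H m m.lt_succ_self⟩), TTS.appTy_bdTy]
    exact ih _ fun j hj => H j (hj.trans m.lt_succ_self)

/-- Here `i` is the last variable place before `m`; the places between them declare nothing. -/
theorem spineCtx_canon_eq_cons {n : ℕ} (α : Inc n) (h : α.shape ⟶ X) {m : ℕ} (E : α.shape.Ty m)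
    {i : ℕ} (hi : i < m) (hi' : i + 1 ∈ Set.range α.val)
    (H : ∀ j, i < j → j < m → j + 1 ∉ Set.range α.val) (E' : α.shape.Ty i) :
    spineCtx m (TTS.appTy h E) (canon α h) =
      (i, (tyExpr (TTS.appTy h E')).bind (canon α h)) ::
        spineCtx i (TTS.appTy h E') (canon α h) := by
  induction m with
  | zero => cases hi
  | succ m ih =>
    obtain hi | rfl := Nat.lt_succ_iff_lt_or_eq.1 hi
    · rw [spineCtx_succ_tmExpr (canon_of_notMem α h
        ⟨(Nat.le_succ _).trans (Inc.succ_le E), H m hi m.lt_succ_self⟩), TTS.appTy_bdTy]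
      exact ih _ hi fun j hj hj' => H j hj (hj'.trans m.lt_succ_self)
    · rw [spineCtx_succ_var (canon_of_mem α h hi'), TTS.appTy_bdTy]
      rfl

theorem canon_bd {n : ℕ} (α : Inc (n + 1)) (h : α.shape ⟶ X) {i : ℕ} (hi : i + 1 ≤ α.bd.last) :
    canon α.bd (α.incl ≫ h) i = canon α h i := by
  induction i using Nat.strong_induction_on with
  | _ i ih =>
    by_cases H : i + 1 ∈ Set.range α.bd.val
    · rw [canon_of_mem _ _ H, canon_of_mem _ _ (α.bd_range_subset H)]
    · rw [canon_of_notMem _ _ ⟨hi, H⟩,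
        canon_of_notMem α h ⟨hi.trans α.bd_last_lt.le, α.notMem_range hi H⟩]
      exact tmExpr_bind_congr _ fun j hj => ih j hj ((Nat.succ_le_succ hj.le).trans hi)

/-- The last variable place has degree `∂α(n+1)`, since the only larger value of `α` is the degree
of the type itself. Its declaration is the type judgement of `(∂α, ∂h)`, which gives compatibility
with boundaries. -/
theorem spineCtx_canon_bd {n : ℕ} (α : Inc (n + 2)) (h : α.shape ⟶ X) :
    spineCtx _ (TTS.appTy h α.top) (canon α h) =
      (α.bd.last - 1,
        (tyExpr (TTS.appTy (α.incl ≫ h) α.bd.top)).bind (canon α.bd (α.incl ≫ h))) ::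
      spineCtx _ (TTS.appTy (α.incl ≫ h) α.bd.top) (canon α.bd (α.incl ≫ h)) := by
  have hp := α.bd.last_pos
  have hlt := α.bd_last_lt
  have hsub : α.bd.last - 1 + 1 = α.bd.last := Nat.sub_add_cancel hp
  have key : ∀ i < α.bd.last - 1, canon α.bd (α.incl ≫ h) i = canon α h i := fun i hi =>
    canon_bd α h (by omega)
  rw [spineCtx_congr _ key, tyExpr_bind_congr _ key]
  refine spineCtx_canon_eq_cons α h α.top (by omega) ?_ (fun j hj hj' hr => ?_)
    (α.tyElt (hsub.le.trans hlt.le))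
  · rw [hsub]
    exact α.bd_range_subset α.bd.last_mem_range
  · have := α.eq_last_of_mem_range hr (by omega)
    omega

theorem length_spineCtx_canon {n : ℕ} (α : Inc (n + 1)) (h : α.shape ⟶ X) :
    (spineCtx _ (TTS.appTy h α.top) (canon α h)).length = n := by
  induction n with
  | zero =>
    rw [spineCtx_canon_eq_nil]
    · rfl
    -- The only values of `α` are `0` and `α.last`, and the latter is the degree of the type, not of
    -- one of its arguments.
    · intro j hj hr
      have := α.eq_last_of_mem_range hr (by rw [Inc.last_zero]; omega)
      omega
  | succ n ih => rw [spineCtx_canon_bd, List.length_cons, ih]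

/-- The type judgement determined by an inc-list and a map. -/
noncomputable def canonTyJ {n : ℕ} (p : Σ α : Inc (n + 1), (α.shape ⟶ X)) :
    (freeGAT {Rule.s} X).TyJ n where
  ctx := spineCtx _ (TTS.appTy p.2 p.1.top) (canon p.1 p.2)
  ty := (tyExpr (TTS.appTy p.2 p.1.top)).bind (canon p.1 p.2)
  len := length_spineCtx_canon p.1 p.2
  der := (canon_isSpine p.1 p.2 _).derivable_ty

/-- The term judgement determined by an inc-list, a map and a term-element. -/
noncomputable def canonTmJ {n : ℕ}
    (a : Σ p : (Σ α : Inc (n + 1), (α.shape ⟶ X)), X.TmOver (TTS.appTy p.2 p.1.top)) :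
    (freeGAT {Rule.s} X).TmJ n where
  ctx := spineCtx _ (TTS.appTy a.1.2 a.1.1.top) (canon a.1.1 a.1.2)
  tm := (tmExpr a.2.1).bind (canon a.1.1 a.1.2)
  ty := (tyExpr (TTS.appTy a.1.2 a.1.1.top)).bind (canon a.1.1 a.1.2)
  len := length_spineCtx_canon a.1.1 a.1.2
  der := (canon_isSpine a.1.1 a.1.2 _).derivable_tm a.2.2

theorem TyJ_bd_eq {n : ℕ} {J : (freeGAT {Rule.s} X).TyJ (n + 1)} {K : (freeGAT {Rule.s} X).TyJ n}
    {x : ℕ} (h : J.ctx = (x, K.ty) :: K.ctx) : J.bd (boundaryClosed X) = K := by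
  obtain ⟨Γ, T, len, der⟩ := J
  obtain rfl : Γ = _ := h
  rfl

theorem canonTyJ_bd {n : ℕ} (p : Σ α : Inc (n + 2), (α.shape ⟶ X)) :
    (canonTyJ p).bd (boundaryClosed X) = canonTyJ ⟨p.1.bd, p.1.incl ≫ p.2⟩ :=
  TyJ_bd_eq (spineCtx_canon_bd p.1 p.2)

theorem canon_comp {n : ℕ} (α : Inc n) (h : α.shape ⟶ X) (f : X ⟶ Y) {i : ℕ}
    (hi : i + 1 ≤ α.last) : canon α (h ≫ f) i = (canon α h i).relabel (symMap f) := by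
  induction i using Nat.strong_induction_on with
  | _ i ih =>
    by_cases H : i + 1 ∈ Set.range α.val
    · rw [canon_of_mem _ _ H, canon_of_mem _ _ H]
      rfl
    · rw [canon_of_notMem _ _ ⟨hi, H⟩, canon_of_notMem _ _ ⟨hi, H⟩, Expr.relabel_bind]
      exact tmExpr_bind_congr _ fun j hj => ih j hj ((Nat.succ_le_succ hj.le).trans hi)

theorem spineCtx_relabel (f : X ⟶ Y) {m : ℕ} (A : X.Ty m) (s : ℕ → Expr (Sym X)) :
    (spineCtx m A s).relabel (symMap f) =
      spineCtx m (TTS.appTy f A) fun i => (s i).relabel (symMap f) := by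
  induction m with
  | zero => rfl
  | succ m ih =>
    cases e : s m with
    | var x =>
      rw [spineCtx_succ_var e, spineCtx_succ_var (x := x) (by simp only [e]; rfl),
        TTS.appTy_bdTy, ← ih]
      simp only [Ctx.relabel, List.map_cons, Expr.relabel_bind]
      rfl
    | app w n t =>
      rw [spineCtx_succ_app e, spineCtx_succ_app (by simp only [e]; rfl), TTS.appTy_bdTy, ← ih]

theorem canonTyJ_map (f : X ⟶ Y) {n : ℕ} (p : Σ α : Inc (n + 1), (α.shape ⟶ X)) :
    canonTyJ ⟨p.1, p.2 ≫ f⟩ = mapTyJ f (canonTyJ p) := by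
  have key : ∀ i < p.1.last - 1, canon p.1 (p.2 ≫ f) i = (canon p.1 p.2 i).relabel (symMap f) :=
    fun i hi => canon_comp p.1 p.2 f (by omega)
  ext1
  · exact (spineCtx_congr _ key).trans (spineCtx_relabel f _ _).symm
  · exact (tyExpr_bind_congr _ key).trans (Expr.relabel_bind (symMap f) _ (tyExpr _)).symm

theorem canonTmJ_map (f : X ⟶ Y) {n : ℕ}
    (a : Σ p : (Σ α : Inc (n + 1), (α.shape ⟶ X)), X.TmOver (TTS.appTy p.2 p.1.top)) :
    canonTmJ ⟨⟨a.1.1, a.1.2 ≫ f⟩, TTS.appTm f a.2.1,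
      (TTS.appTy_bdTm f a.2.1).trans (congrArg (TTS.appTy f) a.2.2)⟩ =
      mapTmJ f (canonTmJ a) := by
  have key : ∀ i < a.1.1.last - 1,
      canon a.1.1 (a.1.2 ≫ f) i = (canon a.1.1 a.1.2 i).relabel (symMap f) :=
    fun i hi => canon_comp a.1.1 a.1.2 f (by omega)
  ext1
  · exact (spineCtx_congr _ key).trans (spineCtx_relabel f _ _).symm
  · exact (tmExpr_bind_congr _ key).trans (Expr.relabel_bind (symMap f) _ (tmExpr _)).symm
  · exact (tyExpr_bind_congr _ key).trans (Expr.relabel_bind (symMap f) _ (tyExpr _)).symm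

end Free

/-! ### Maps out of `[α]` and bijectivity on congruence classes -/

namespace TTS

variable {X Y : TTS.{u}}

/-- The successive boundaries of a type-element. -/
def descend (X : TTS.{u}) {m : ℕ} (A : X.Ty m) {i : ℕ} (h : i ≤ m) : X.Ty i :=
  Nat.decreasingInduction (motive := fun k _ => X.Ty k) (fun _ _ B => X.bdTy B) A h

theorem descend_self {m : ℕ} (A : X.Ty m) : X.descend A le_rfl = A :=
  Nat.decreasingInduction_self _ _

theorem bdTy_descend {m : ℕ} (A : X.Ty m) {i : ℕ} (h : i + 1 ≤ m) :
    X.bdTy (X.descend A h) = X.descend A ((Nat.le_succ i).trans h) :=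
  (Nat.decreasingInduction_succ_left _ _ h _).symm

theorem descend_bdTy {m : ℕ} (A : X.Ty (m + 1)) {i : ℕ} (h : i ≤ m) :
    X.descend (X.bdTy A) h = X.descend A (h.trans m.le_succ) :=
  (Nat.decreasingInduction_succ (motive := fun k _ => X.Ty k) (fun _ _ B => X.bdTy B) A h _).symm

/-- A map of presheaves is invertible if it is bijective on type- and term-elements. -/
theorem isIso_of_bijective (f : X ⟶ Y) (h : ∀ k, Function.Bijective (appTy f (k := k)))
    (h' : ∀ k, Function.Bijective (appTm f (k := k))) : IsIso f := by
  rw [NatTrans.isIso_iff_isIso_app]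
  rintro ⟨k | k⟩
  · rw [isIso_iff_bijective]
    exact h k
  · rw [isIso_iff_bijective]
    exact h' k

/-- Every type-element of `[α]` is a successive boundary of the top one. -/
theorem inc_hom_ext {n : ℕ} {α : Inc (n + 1)} {g h : α.shape ⟶ X}
    (H : appTy g α.top = appTy h α.top)
    (H' : ∀ i (E : α.shape.Tm i), appTm g E = appTm h E) : g = h := by
  refine hom_ext (fun i E => ?_) H'
  have hi : i ≤ α.last - 1 := Nat.le_sub_one_of_lt (Inc.succ_le E)
  revert E
  induction hi using Nat.decreasingInduction with
  | self => exact fun _ => H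
  | of_succ i hi ih =>
    intro E
    have := congrArg X.bdTy (ih (α.tyElt (by omega)))
    rwa [appTy_bdTy, appTy_bdTy] at this

end TTS

theorem Inc.ext_of_range {n : ℕ} {α β : Inc n} (h : Set.range α.val = Set.range β.val) : α = β :=
  Inc.ext ((α.mono.range_inj β.mono).1 h)

/-- The inc-list enumerating a finite set which contains `0`. -/
theorem Inc.exists_range_eq {n : ℕ} {F : Finset ℕ} (h : F.card = n + 1) (h0 : 0 ∈ F) :
    ∃ α : Inc n, Set.range α.val = F := by
  have hr := F.range_orderEmbOfFin h
  have hm := (F.orderEmbOfFin h).strictMono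
  refine ⟨⟨F.orderEmbOfFin h, ?_, hm⟩, hr⟩
  obtain ⟨j, hj⟩ : 0 ∈ Set.range (F.orderEmbOfFin h) := by
    rw [hr]
    exact h0
  exact Nat.le_zero.1 ((hm.monotone (Fin.zero_le j)).trans hj.le)

theorem Inc.last_eq {n : ℕ} {α : Inc n} {F : Finset ℕ} (h : Set.range α.val = F) {x : ℕ}
    (hx : x ∈ F) (hF : ∀ y ∈ F, y ≤ x) : α.last = x := by
  apply le_antisymm
  · apply hF
    rw [← Finset.mem_coe, ← h]
    exact α.last_mem_range
  · rw [← Finset.mem_coe, ← h] at hx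
    obtain ⟨j, rfl⟩ := hx
    exact α.mono.monotone (Fin.le_last j)

namespace Free

variable {X : TTS.{u}}

theorem IsSpine.eq_var_or {m : ℕ} {A : X.Ty m} {s : ℕ → Expr (Sym X)} (hs : IsSpine m A s)
    {i : ℕ} (hi : i < m) :
    (∃ x, s i = .var x) ∨
      ∃ a : X.Tm i, X.bdTm a = X.descend A hi.le ∧ s i = (tmExpr a).bind s := by
  induction m with
  | zero => cases hi
  | succ m ih =>
    obtain hi | rfl := Nat.lt_succ_iff_lt_or_eq.1 hi
    · rw [← TTS.descend_bdTy A hi.le]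
      exact ih hs.1 hi
    · rw [← TTS.descend_bdTy A le_rfl, TTS.descend_self]
      exact hs.eq_or

open Classical in
theorem length_spineCtx {m : ℕ} (A : X.Ty m) (s : ℕ → Expr (Sym X)) :
    (spineCtx m A s).length = ((Finset.range m).filter fun i => ∃ x, s i = .var x).card := by
  induction m with
  | zero => rfl
  | succ m ih =>
    rw [Finset.range_add_one, Finset.filter_insert]
    cases e : s m with
    | var x =>
      rw [spineCtx_succ_var e, if_pos ⟨x, rfl⟩, Finset.card_insert_of_notMem (by simp),
        List.length_cons, ih]
    | app w n t => rw [spineCtx_succ_app e, if_neg (by simp), ih]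

/-- Every spine has the pattern of the judgement determined by an inc-list and a map. -/
theorem IsSpine.exists_canon {m k : ℕ} {A : X.Ty m} {s : ℕ → Expr (Sym X)} (hs : IsSpine m A s)
    (hk : (spineCtx m A s).length = k) :
    ∃ (α : Inc (k + 1)) (h : α.shape ⟶ X) (E : α.shape.Ty m), α.last = m + 1 ∧
      TTS.appTy h E = A ∧ SamePattern X m (canon α h) s := by
  classical
  set V : Finset ℕ := (Finset.range m).filter fun i => ∃ x, s i = .var x with hV
  have hVm : ∀ i ∈ V, i < m := fun i hi => Finset.mem_range.1 (Finset.mem_filter.1 hi).1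
  -- The image of the future inc-list: `0`, the degree `m + 1` of `A`, and the degrees `i + 1` of
  -- the variable places `i`.
  set F : Finset ℕ := insert 0 (insert (m + 1) (V.image Nat.succ)) with hF
  have hcard : F.card = k + 1 + 1 := by
    rw [hF, Finset.card_insert_of_notMem, Finset.card_insert_of_notMem,
      Finset.card_image_of_injective _ Nat.succ_injective, hV, ← length_spineCtx A, hk]
    · intro h
      obtain ⟨i, hi, h⟩ := Finset.mem_image.1 h
      have := hVm i hi
      omega
    · simp
  obtain ⟨α, hα⟩ := Inc.exists_range_eq hcard (Finset.mem_insert_self _ _)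
  have hlast : α.last = m + 1 := by
    refine Inc.last_eq hα (by simp [hF]) fun y hy => ?_
    simp only [hF, Finset.mem_insert, Finset.mem_image] at hy
    obtain rfl | rfl | ⟨i, hi, rfl⟩ := hy
    · exact Nat.zero_le _
    · exact le_rfl
    · exact Nat.succ_le_succ (hVm i hi).le
  have hmem : ∀ i < m, i + 1 ∈ Set.range α.val ↔ ∃ x, s i = .var x := by
    intro i hi
    rw [hα]
    simp [hF, hV, hi, hi.ne]
  have hlt : ∀ {i}, i + 1 ≤ α.last ∧ i + 1 ∉ Set.range α.val → i < m := by
    rintro i ⟨H, H'⟩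
    have : i + 1 ≠ α.last := fun h => H' (h ▸ α.last_mem_range)
    omega
  -- A place whose degree is not in the image is not a variable, so the spine supplies a
  -- term-element there.
  have hg : ∀ i (E : (α.shape : TTS.{u}).Tm i), ∃ a : X.Tm i,
      X.bdTm a = X.descend A (hlt (Inc.tm_prop E)).le ∧ s i = (tmExpr a).bind s := fun i E =>
    (hs.eq_var_or (hlt (Inc.tm_prop E))).resolve_left fun h =>
      (Inc.tm_prop E).2 ((hmem i (hlt (Inc.tm_prop E))).2 h)
  choose g hg₁ hg₂ using hg
  have hle : ∀ {i}, (α.shape : TTS.{u}).Ty i → i ≤ m := fun E =>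
    Nat.le_of_succ_le_succ ((Inc.succ_le E).trans hlast.le)
  -- The map sends type-elements to the successive boundaries of `A` and term-elements to the head
  -- constants of the spine.
  refine ⟨α, TTS.homMk (fun i E => X.descend A (hle E)) g
    (fun i E => TTS.bdTy_descend A _) hg₁, α.tyElt hlast.ge, hlast, TTS.descend_self A, ?_⟩
  intro i hi
  by_cases H : i + 1 ∈ Set.range α.val
  · obtain ⟨x, hx⟩ := (hmem i hi).1 H
    exact Or.inl ⟨i, x, canon_of_mem _ _ H, hx⟩
  · exact Or.inr ⟨_, canon_of_notMem _ _ ⟨by omega, H⟩, hg₂ i _⟩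

/-- The head constant gives the degree `α.last` and the value of the map at the top. Among the
arguments, those that are variables give the image of `α`, and the heads of the others give the map
on term-elements. -/
theorem eq_of_erase_eq {n : ℕ} {p q : Σ α : Inc (n + 1), (α.shape ⟶ X)}
    (H : (canonTyJ p).ty.erase = (canonTyJ q).ty.erase) : p = q := by
  obtain ⟨α, h⟩ := p
  obtain ⟨β, g⟩ := q
  simp only [canonTyJ, Expr.erase, Expr.bind_bind] at H
  obtain ⟨hA, hs⟩ := tyExpr_bind_inj H
  have hlast : α.last = β.last := by
    have h₁ : α.last - 1 = β.last - 1 := congrArg Sigma.fst hA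
    have h₂ := α.last_pos
    have h₃ := β.last_pos
    omega
  have hmem : ∀ i < α.last - 1, i + 1 ∈ Set.range α.val ↔ i + 1 ∈ Set.range β.val := by
    intro i hi
    have hsi := hs i hi
    by_cases H₁ : i + 1 ∈ Set.range α.val <;> by_cases H₂ : i + 1 ∈ Set.range β.val
    · simp [H₁, H₂]
    · rw [canon_of_mem _ _ H₁, canon_of_notMem _ _ ⟨by omega, H₂⟩] at hsi
      cases hsi
    · rw [canon_of_mem _ _ H₂, canon_of_notMem _ _ ⟨by omega, H₁⟩] at hsi
      cases hsi
    · simp [H₁, H₂]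
  obtain rfl : α = β := by
    apply Inc.ext_of_range
    ext x
    obtain _ | x := x
    · exact iff_of_true ⟨0, α.zero⟩ ⟨0, β.zero⟩
    by_cases hx : x < α.last - 1
    · exact hmem x hx
    by_cases hx' : x + 1 = α.last
    · exact iff_of_true (hx' ▸ α.last_mem_range) ((hx'.trans hlast) ▸ β.last_mem_range)
    · refine iff_of_false ?_ ?_ <;> rintro ⟨j, hj⟩
      · have : _ ≤ α.last := α.mono.monotone (Fin.le_last j)
        omega
      · have : _ ≤ β.last := β.mono.monotone (Fin.le_last j)
        omega
  obtain rfl : h = g := by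
    refine TTS.inc_hom_ext (eq_of_heq (Sigma.mk.inj hA).2) fun i E => ?_
    have hE := Inc.tm_prop E
    have hne : i + 1 ≠ α.last := fun h => hE.2 (h ▸ α.last_mem_range)
    have hsi := hs i (by omega)
    rw [canon_of_notMem _ _ hE, canon_of_notMem _ _ hE, Expr.bind_bind, Expr.bind_bind] at hsi
    exact eq_of_heq (Sigma.mk.inj (tmExpr_bind_inj hsi).1).2
  rfl

/-- Erasure descends to the quotient, so an equality of classes can be used without showing that the
congruence is an equivalence relation. -/
theorem canonTyJ_injective {n : ℕ} {p q : Σ α : Inc (n + 1), (α.shape ⟶ X)}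
    (H : Quot.mk (GAT.TyJ.Rel (freeGAT {Rule.s} X)) (canonTyJ p) = Quot.mk _ (canonTyJ q)) :
    p = q :=
  eq_of_erase_eq (congrArg
    (Quot.lift (fun J => J.ty.erase) fun _ _ (r : GAT.TyJ.Rel _ _ _) => erase_eq_of_tyCongr r) H)

theorem canonTmJ_injective {n : ℕ}
    {a b : Σ p : (Σ α : Inc (n + 1), (α.shape ⟶ X)), X.TmOver (TTS.appTy p.2 p.1.top)}
    (H : Quot.mk (GAT.TmJ.Rel (freeGAT {Rule.s} X)) (canonTmJ a) = Quot.mk _ (canonTmJ b)) :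
    a = b := by
  have hty : (canonTmJ a).ty.erase = (canonTmJ b).ty.erase := congrArg
    (Quot.lift (fun J => J.ty.erase) fun _ _ (r : GAT.TmJ.Rel _ _ _) => erase_eq_of_tyCongr r.1) H
  have htm : (canonTmJ a).tm.erase = (canonTmJ b).tm.erase := congrArg
    (Quot.lift (fun J => J.tm.erase) fun _ _ (r : GAT.TmJ.Rel _ _ _) => erase_eq_of_tmCongr r) H
  obtain ⟨p, a, ha⟩ := a
  obtain ⟨q, b, hb⟩ := b
  obtain rfl : p = q := eq_of_erase_eq hty
  simp only [canonTmJ, Expr.erase, Expr.bind_bind] at htm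
  obtain rfl : a = b := eq_of_heq (Sigma.mk.inj (tmExpr_bind_inj htm).1).2
  rfl

theorem exists_canonTyJ_rel {n : ℕ} (J : (freeGAT {Rule.s} X).TyJ n) :
    ∃ p, GAT.TyJ.Rel (freeGAT {Rule.s} X) (canonTyJ p) J := by
  obtain ⟨Γ, T, len, der⟩ := J
  obtain ⟨m, A, s, hs, rfl, rfl⟩ := normal_of_derivable der
  obtain ⟨α, h, E, hlast, rfl, hp⟩ := hs.exists_canon len
  -- In this degree `[α]` has a single type-element, so `E` is `α.top` by definition.
  obtain rfl : m = α.last - 1 := by omega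
  exact ⟨⟨α, h⟩, (canon_isSpine α h E).tyCongr hs hp⟩

theorem exists_canonTmJ_rel {n : ℕ} (J : (freeGAT {Rule.s} X).TmJ n) :
    ∃ a, GAT.TmJ.Rel (freeGAT {Rule.s} X) (canonTmJ a) J := by
  obtain ⟨Γ, t, T, len, der⟩ := J
  obtain ⟨m, a, s, hs, rfl, rfl, rfl⟩ := normal_of_derivable der
  obtain ⟨α, h, E, hlast, hE, hp⟩ := hs.exists_canon len
  obtain rfl : m = α.last - 1 := by omega
  refine ⟨⟨⟨α, h⟩, a, hE.symm⟩, ?_⟩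
  have hE : TTS.appTy h α.top = X.bdTm a := hE
  have hc : IsSpine _ (X.bdTm a) (canon α h) := hE ▸ canon_isSpine α h α.top
  dsimp only [GAT.TmJ.Rel, canonTmJ]
  rw [hE]
  exact hc.tmCongr hs hp rfl

end Free

/-! ### The natural isomorphism -/

/-- The judgements determined by inc-lists and maps, as a map of type-and-term structures. -/
noncomputable def incToSubst (X : TTS.{u}) : incFunctor.obj X ⟶ substFunctor.obj X :=
  TTS.homMk (X := incObj X) (Y := (freeGAT {Rule.s} X).toTTS (Free.boundaryClosed X))
    (fun _ p => Quot.mk _ (Free.canonTyJ p))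
    (fun _ a => Quot.mk _ (Free.canonTmJ a))
    (fun _ p => congrArg (Quot.mk _) (Free.canonTyJ_bd p))
    (fun _ _ => rfl)

instance (X : TTS.{u}) : IsIso (incToSubst X) :=
  TTS.isIso_of_bijective _
    (fun _ => ⟨fun _ _ => Free.canonTyJ_injective, Quot.ind fun J =>
      (Free.exists_canonTyJ_rel J).imp fun _ h => Quot.sound h⟩)
    (fun _ => ⟨fun _ _ => Free.canonTmJ_injective, Quot.ind fun J =>
      (Free.exists_canonTmJ_rel J).imp fun _ h => Quot.sound h⟩)

theorem incToSubst_naturality {X Y : TTS.{u}} (f : X ⟶ Y) :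
    incFunctor.map f ≫ incToSubst Y = incToSubst X ≫ substFunctor.map f :=
  TTS.hom_ext
    (fun _ p => congrArg (Quot.mk _) (Free.canonTyJ_map f p))
    (fun _ a => congrArg (Quot.mk _) (Free.canonTmJ_map f a))

end SubstGAT

theorem mainTheorem9 :
    Nonempty (SubstGAT.substFunctor.{u} ≅ SubstGAT.incFunctor.{u}) :=
  ⟨(NatIso.ofComponents (fun X => asIso (SubstGAT.incToSubst X))
    fun f => SubstGAT.incToSubst_naturality f).symm⟩
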